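/- Let $\mathfrak g$ be a finite-dimensional Lie algebra over an algebraically closed field $k$ (of arbitrary characteristic). Let $\mathcal C_2(\mathfrak g)=\{(x,y)\in\mathfrak g\times\mathfrak g : [x,y]=0\}$ be its commuting variety and $\mathrm{pr}_1:\mathcal C_2(\mathfrak g)\to\mathfrak g$ the first projection. For $n\ge 0$ let $\mathfrak g_{(n)}=\{x\in\mathfrak g : \mathrm{rk}(\mathrm{ad}\,x)=n\}$, a locally closed subset of $\mathfrak g$, let $\mathbb N_0(\mathfrak g)=\{n : \mathfrak g_{(n)}\neq\emptyset\}$, and put $$\mathrm{mod}(\mathfrak g)=\max_{n\in\mathbb N_0(\mathfrak g)}\bigl(\dim\mathfrak g_{(n)}-n\bigr).$$ For $X\subseteq\mathfrak g$ write $\mathcal C_2(\mathfrak g)|_X=\mathrm{pr}_1^{-1}(X)$, and let $C_{\mathfrak g}(x)=\{y : [x,y]=0\}$. Topological notions and dimensions refer to the Zariski topology (with $\dim\emptyset=-1$), and $\mathrm{Irr}$ denotes the set of irreducible components. Then the following hold. 1. (a) If $n\in\mathbb N_0(\mathfrak g)$, then $\mathrm{pr}_1:\mathcal C_2(\mathfrak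 g)|_{\mathfrak g_{(n)}}\to\mathfrak g_{(n)}$ is an algebraic vector bundle of rank $\dim_k\mathfrak g-n$; in particular, this morphism is open. (b) If $X\in\mathrm{Irr}(\mathfrak g_{(n)})$, then $\overline{\mathrm{pr}_1^{-1}(X)}\subseteq\mathcal C_2(\mathfrak g)$ is irreducible of dimension $\dim X+\dim_k\mathfrak g-n$. 2. $\dim\mathcal C_2(\mathfrak g)=\dim_k\mathfrak g+\mathrm{mod}(\mathfrak g)$. 3. If $C\in\mathrm{Irr}(\mathcal C_2(\mathfrak g))$, then $\dim C=\dim\mathrm{pr}_1(C)+\dim_k\mathfrak g-n_C$, where $n_C=\max\{n : \mathfrak g_{(n)}\cap\mathrm{pr}_1(C)\neq\emptyset\}$. 4. If $X\in\mathrm{Irr}(\mathfrak g_{(n)})$ is such that $\overline{\mathrm{pr}_1^{-1}(X)}\in\mathrm{Irr}(\mathcal C_2(\mathfrak g))$, then $$C_{\mathfrak g}(x)\subseteq\overline X\subseteq\overline{\mathfrak g_{(n)}}\subseteq\bigsqcup_{m\le n}\mathfrak g_{(m)}\qquad\text{for all }x\in X.$$ 5. If $n$ is such that $\mathrm{mod}(\mathfrak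 g)=\dim\mathfrak g_{(n)}-n$, then $\overline{\mathrm{pr}_1^{-1}(X)}\in\mathrm{Irr}(\mathcal C_2(\mathfrak g))$ for every $X\in\mathrm{Irr}(\mathfrak g_{(n)})$ with $\dim X=\dim\mathfrak g_{(n)}$. -/

import Mathlib

namespace CommVar

section Zariski

variable (k : Type*) [Field k]
variable {V : Type*} [AddCommGroup V] [Module k V]
variable {W : Type*} [AddCommGroup W] [Module k W]

/-- The algebra `k[V]` of polynomial functions on a vector space, generated by the linear forms. -/
def polyFun (V : Type*) [AddCommGroup V] [Module k V] : Subalgebra k (V → k) :=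
  Algebra.adjoin k (Set.range fun φ : Module.Dual k V => (φ : V → k))

/-- The set of common zeros of a set of functions. -/
def zeros (P : Set (V → k)) : Set V := {v | ∀ p ∈ P, p v = 0}

/-- The Zariski topology on the set of points of the affine space `V`: the closed sets are the
sets of common zeros of polynomial functions. -/
@[reducible] def zariski (V : Type*) [AddCommGroup V] [Module k V] : TopologicalSpace V :=
  TopologicalSpace.ofClosed {Z : Set V | ∃ P : Set (V → k), P ⊆ polyFun k V ∧ Z = zeros k P}
    ⟨{1}, by simp, by ext v; simp [zeros]⟩
    (by
      intro A hA
      refine ⟨{p | p ∈ polyFun k V ∧ ∃ Z ∈ A, ∀ v ∈ Z, p v = 0}, fun p hp => hp.1, ?_⟩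
      ext v
      constructor
      · rintro hv p ⟨-, Z, hZ, hpZ⟩
        exact hpZ v (hv Z hZ)
      · intro hv Z hZ
        obtain ⟨P, hP, rfl⟩ := hA hZ
        intro p hp
        exact hv p ⟨hP hp, _, hZ, fun w hw => hw p hp⟩)
    (by
      rintro _ ⟨P, hP, rfl⟩ _ ⟨Q, hQ, rfl⟩
      refine ⟨{f | ∃ p ∈ P, ∃ q ∈ Q, f = p * q}, ?_, ?_⟩
      · rintro _ ⟨p, hp, q, hq, rfl⟩
        exact (polyFun k V).mul_mem (hP hp) (hQ hq)
      · ext v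
        constructor
        · rintro (hv | hv) _ ⟨p, hp, q, hq, rfl⟩
          · simp [hv p hp]
          · simp [hv q hq]
        · intro hv
          by_contra hcon
          rw [Set.mem_union, not_or] at hcon
          simp only [zeros, Set.mem_ofPred_eq, not_forall] at hcon
          obtain ⟨⟨p, hp, hpv⟩, q, hq, hqv⟩ := hcon
          have := hv _ ⟨p, hp, q, hq, rfl⟩
          simp [hpv, hqv] at this)

/-- Zariski closure of a subset of an affine space. -/
def zclosure (S : Set V) : Set V := @closure V (zariski k V) S

/-- Irreducibility (which includes non-emptiness) for the Zariski topology. -/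
def ZIrreducible (S : Set V) : Prop := @IsIrreducible V (zariski k V) S

/-- `Irr(S)`: the irreducible components of `S` with its subspace topology, as subsets of `V`. -/
def Irr (S : Set V) : Set (Set V) :=
  letI : TopologicalSpace V := zariski k V
  (fun X : Set S => ((↑) : S → V) '' X) '' irreducibleComponents S

/-- Krull dimension of `S` with its subspace topology; `dim ∅ = -1`. The value is finite by
`krullDim_lt_top` below, so that `ENat.toNat` loses nothing. -/
noncomputable def zdim (S : Set V) : ℤ :=
  letI : TopologicalSpace V := zariski k V
  ((topologicalKrullDim S).map fun d : ℕ∞ => (d.toNat : ℤ)).unbotD (-1)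

/-- Openness of a map between subsets of affine spaces with their subspace topologies. -/
def ZOpenMap {S : Set V} {T : Set W} (f : S → T) : Prop :=
  letI : TopologicalSpace V := zariski k V
  letI : TopologicalSpace W := zariski k W
  IsOpenMap f

/-- `f` restricts to a regular function on the (locally closed) subset `S`: near each point of `S`
it is a quotient of polynomial functions. -/
def RegularOn (f : V → k) (S : Set V) : Prop :=
  ∀ x ∈ S, ∃ p ∈ polyFun k V, ∃ q ∈ polyFun k V, q x ≠ 0 ∧ ∀ y ∈ S, q y ≠ 0 → f y = p y / q y

/-- `f` restricts to a morphism from the (locally closed) subset `S` to the affine space `W`. -/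
def MorphismOn (f : V → W) (S : Set V) : Prop :=
  ∀ φ : Module.Dual k W, RegularOn k (fun v => φ (f v)) S

/-- Local trivialisation of rank `r` of the first projection `E → X` over the open part `X ∩ U` of
the base: mutually inverse morphisms between `E ∩ pr₁⁻¹(U)` and `(X ∩ U) × k^r`, compatible with the
projections and linear on the fibres. -/
structure IsTrivialisation (E : Set (V × W)) (X U : Set V) (r : ℕ)
    (Φ : V × W → V × (Fin r → k)) (Ψ : V × (Fin r → k) → V × W) : Prop where
  morphism_to : MorphismOn k Φ (E ∩ Prod.fst ⁻¹' U)
  morphism_inv : MorphismOn k Ψ ((X ∩ U) ×ˢ Set.univ)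
  mapsTo : Set.MapsTo Φ (E ∩ Prod.fst ⁻¹' U) ((X ∩ U) ×ˢ Set.univ)
  mapsTo_inv : Set.MapsTo Ψ ((X ∩ U) ×ˢ Set.univ) (E ∩ Prod.fst ⁻¹' U)
  invOn : Set.InvOn Ψ Φ (E ∩ Prod.fst ⁻¹' U) ((X ∩ U) ×ˢ Set.univ)
  fst_eq : ∀ z ∈ E ∩ Prod.fst ⁻¹' U, (Φ z).1 = z.1
  linear : ∀ x ∈ X ∩ U, IsLinearMap k fun c : Fin r → k => (Ψ (x, c)).2

/-- `pr₁ : E → X` is an (algebraic) vector bundle of rank `r`, where `X ⊆ V` and `E ⊆ X × W` are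
locally closed and the vector space structures of the fibres are those of subspaces of `W`. -/
structure IsVectorBundle (E : Set (V × W)) (X : Set V) (r : ℕ) : Prop where
  base_locallyClosed : @IsLocallyClosed V (zariski k V) X
  total_locallyClosed : @IsLocallyClosed (V × W) (zariski k (V × W)) E
  proj_mem : ∀ z ∈ E, z.1 ∈ X
  fibre_subspace : ∀ x ∈ X, ∃ F : Submodule k W, (F : Set W) = {w | (x, w) ∈ E}
  locally_trivial : ∀ x ∈ X, ∃ U : Set V, @IsOpen V (zariski k V) U ∧ x ∈ U ∧
    ∃ Φ Ψ, IsTrivialisation k E X U r Φ Ψ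

end Zariski

section Lie

variable (k : Type*) [Field k] (g : Type*) [LieRing g] [LieAlgebra k g]

/-- The commuting variety `C₂(g)`. -/
def commutingVariety : Set (g × g) := {z | ⁅z.1, z.2⁆ = 0}

/-- `pr₁⁻¹(X)` for `pr₁ : C₂(g) → g` and `X ⊆ g`; this is the total space of `C₂(g)|_X`. -/
def fibration {g : Type*} [LieRing g] (X : Set g) : Set (g × g) :=
  {z | z ∈ commutingVariety g ∧ z.1 ∈ X}

/-- The restriction `pr₁ : C₂(g)|_X → X` of the first projection. -/
def pr₁ {g : Type*} [LieRing g] (X : Set g) : fibration X → X := fun z => ⟨z.1.1, z.2.2⟩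

/-- The rank stratum `g_(n)` of elements `x` with `rk (ad x) = n`. -/
def stratum (n : ℕ) : Set g :=
  {x | Module.finrank k (LinearMap.range (LieAlgebra.ad k g x : g →ₗ[k] g)) = n}

/-- The values `dim g_(n) - n` for the non-empty strata. -/
def modalityValues : Set ℤ := {m | ∃ n : ℕ, (stratum k g n).Nonempty ∧ m = zdim k (stratum k g n) - n}

/-- `mod(g)`, the maximum of `dim g_(n) - n` over the non-empty strata; the maximum is attained by
`isGreatest_modality` below. -/
noncomputable def modality : ℤ := sSup (modalityValues k g)

end Lie

section WellDefined

variable (k : Type*) [Field k]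

theorem krullDim_lt_top {V : Type*} [AddCommGroup V] [Module k V] [FiniteDimensional k V]
    (S : Set V) :
    let _ : TopologicalSpace V := zariski k V
    topologicalKrullDim S < ⊤ := by
  let _ : TopologicalSpace V := zariski k V
  let A := polyFun k V
  let I : Set V → Ideal A := fun Z =>
    { carrier := {p | ∀ v ∈ Z, p.1 v = 0}
      zero_mem' := fun v _ => rfl
      add_mem' := fun {p q} hp hq v hv => by simp [hp v hv, hq v hv]
      smul_mem' := fun p q hq v hv => by simp [hq v hv] }
  have hI : ∀ Z W : Set V, IsClosed Z → IsClosed W → I Z ≤ I W → W ⊆ Z := by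
    intro Z W hZ _ h v hv
    obtain ⟨P, hP, hPZ⟩ : ∃ P : Set (V → k), P ⊆ polyFun k V ∧ Z = zeros k P := by
      have := hZ.isOpen_compl
      change Zᶜᶜ ∈ _ at this
      rwa [compl_compl] at this
    rw [hPZ]
    intro p hp
    refine h (x := ⟨p, hP hp⟩) ?_ v hv
    intro w hw
    rw [hPZ] at hw
    exact hw p hp
  have hanti : ∀ Z W : Set V, Z ⊆ W → I W ≤ I Z := fun Z W h p hp v hv => hp v (h hv)
  have hopen : ∀ p : A, IsOpen {v | p.1 v ≠ 0} := by
    intro p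
    change {v | p.1 v ≠ 0}ᶜ ∈ _
    exact ⟨{p.1}, by simp, by ext v; simp [zeros]⟩
  have hprime : ∀ Z : Set V, IsIrreducible Z → (I Z).IsPrime := by
    intro Z hZ
    refine ⟨?_, ?_⟩
    · intro htop
      obtain ⟨v, hv⟩ := hZ.1
      have : (1 : A) ∈ I Z := htop ▸ Submodule.mem_top
      simpa using this v hv
    · intro p q hpq
      by_contra hcon
      rw [not_or] at hcon
      obtain ⟨hp, hq⟩ := hcon
      have hp' : (Z ∩ {v | p.1 v ≠ 0}).Nonempty := by
        by_contra hne
        refine hp fun v hv => ?_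
        by_contra h0
        exact hne ⟨v, hv, h0⟩
      have hq' : (Z ∩ {v | q.1 v ≠ 0}).Nonempty := by
        by_contra hne
        refine hq fun v hv => ?_
        by_contra h0
        exact hne ⟨v, hv, h0⟩
      obtain ⟨v, hv, h1, h2⟩ := hZ.2 _ _ (hopen p) (hopen q) hp' hq'
      have := hpq v hv
      simp only [MulMemClass.coe_mul, Pi.mul_apply, mul_eq_zero] at this
      exact this.elim h1 h2
  let F : TopologicalSpace.IrreducibleCloseds V → (PrimeSpectrum A)ᵒᵈ := fun Z =>
    OrderDual.toDual ⟨I Z, hprime _ Z.isIrreducible'⟩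
  have hF : StrictMono F := by
    intro Z W h
    have h1 : (Z : Set V) ⊆ W := h.le
    refine lt_of_le_not_ge (show I W ≤ I Z from hanti _ _ h1) fun h2 => ?_
    have h3 : I (Z : Set V) ≤ I (W : Set V) := h2
    exact h.not_ge (show (W : Set V) ⊆ Z from hI _ _ Z.isClosed' W.isClosed' h3)
  have e1 : topologicalKrullDim V ≤ ringKrullDim A := by
    have := Order.krullDim_le_of_strictMono F hF
    rwa [Order.krullDim_orderDual] at this
  let b := Module.finBasis k V
  let G : MvPolynomial (Fin (Module.finrank k V)) k →ₐ[k] (V → k) :=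
    MvPolynomial.aeval fun i => (b.coord i : V → k)
  have hG : A ≤ G.range := by
    refine Algebra.adjoin_le ?_
    rintro _ ⟨φ, rfl⟩
    refine ⟨∑ i, MvPolynomial.C (φ (b i)) * MvPolynomial.X i, ?_⟩
    funext v
    have hv : φ v = ∑ i, b.repr v i * φ (b i) := by
      conv_lhs => rw [← b.sum_repr v]
      simp only [map_sum, map_smul, smul_eq_mul]
    change G _ v = φ v
    rw [hv, map_sum, Finset.sum_apply]
    refine Finset.sum_congr rfl fun i _ => ?_
    simp [G, mul_comm]
  have hG' : ∀ p, G p ∈ A := by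
    intro p
    have : G p ∈ G.range := ⟨p, rfl⟩
    refine (?_ : G.range ≤ A) this
    rw [← Algebra.adjoin_range_eq_range_aeval]
    refine Algebra.adjoin_mono ?_
    rintro _ ⟨i, rfl⟩
    exact ⟨b.coord i, rfl⟩
  have e2 : ringKrullDim A ≤ ringKrullDim (MvPolynomial (Fin (Module.finrank k V)) k) := by
    refine ringKrullDim_le_of_surjective ((G.codRestrict A hG').toRingHom) ?_
    rintro ⟨p, hp⟩
    obtain ⟨q, hq⟩ := hG hp
    exact ⟨q, Subtype.ext hq⟩
  have e3 : ringKrullDim (MvPolynomial (Fin (Module.finrank k V)) k) < ⊤ := by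
    rw [MvPolynomial.ringKrullDim_of_isNoetherianRing, ringKrullDim_eq_zero_of_field, zero_add]
    exact WithBot.coe_lt_coe.2 (ENat.natCast_lt_top _)
  exact (topologicalKrullDim_subspace_le V S).trans_lt ((e1.trans e2).trans_lt e3)

theorem stratum_zero_nonempty (g : Type*) [LieRing g] [LieAlgebra k g] :
    (stratum k g 0).Nonempty := ⟨0, by
  change Module.finrank k (LinearMap.range (LieAlgebra.ad k g 0 : g →ₗ[k] g)) = 0
  rw [map_zero, LinearMap.range_zero, finrank_bot]⟩

theorem isGreatest_modality (g : Type*) [LieRing g] [LieAlgebra k g] [FiniteDimensional k g] :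
    IsGreatest (modalityValues k g) (modality k g) := by
  have hfin : (modalityValues k g).Finite := by
    refine ((Set.finite_Iic (Module.finrank k g)).image
      fun n : ℕ => zdim k (stratum k g n) - (n : ℤ)).subset ?_
    rintro m ⟨n, ⟨x, hx⟩, rfl⟩
    exact ⟨n, hx ▸ Submodule.finrank_le _, rfl⟩
  have hne : (modalityValues k g).Nonempty := ⟨_, 0, stratum_zero_nonempty k g, rfl⟩
  exact ⟨hne.csSup_mem hfin, fun m hm => le_csSup hfin.bddAbove hm⟩

end WellDefined

end CommVar

open CommVar

/-!
The set of commuting pairs is the set of zeros of the linear family `x ↦ ad x` of linear maps, and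
its structure is governed by the ranks of the members of this family.

Near a point `x₀` the endomorphism `1 + q ∘ ad (x - x₀)`, where `q` is a generalized inverse of
`ad x₀`, is invertible. It maps `ker (ad x)` injectively into `ker (ad x₀)`, so the rank cannot
drop near `x₀`; where the rank stays the same the map is bijective, and Cramer's rule for its
inverse trivialises the kernels (`exists_isTrivialisation_kernelFamily`). So the commuting variety
is a vector bundle over every stratum. The projection of a bundle is open with irreducible fibres,
so the total space over an irreducible base `X` is irreducible, and its dimension is `dim X` plus
the rank (`IsVectorBundle.zIrreducible`, `IsVectorBundle.zdim_zclosure`).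

The dimension formula rests on the identification of the dimension of an irreducible locally
closed set with the Krull dimension of its coordinate ring
(`topologicalKrullDim_eq_ringKrullDim`). This uses the Nullstellensatz and the fact that inverting
a non-zero element of an affine domain does not change the dimension, since the dimension is the
transcendence degree (`ringKrullDim_eq_trdeg`). Consequently dense open subsets have full
dimension, and multiplying by `k^r` adds `r`, because it replaces the coordinate ring by a
polynomial ring over it.

On a component `C` of the commuting variety the rank of `ad x` takes its maximal value `n` on a
dense open subset, which lies over one component `X` of the stratum of rank `n`; by maximality `C`
is the closure of the preimage of `X` (`exists_eq_zclosure_fibration`). The dimension formulas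
follow. If `C` contains `(x, y)`, then it contains `(y, y)`, since it is stable under the
connected family of maps `(x, y) ↦ ((1 - c) x + c y, y)` (`snd_snd_mem_of_mem_Irr`); so
centralizers of points of `X` lie in the closure of `X`. Finally, a closure of the preimage of
some `X` whose dimension is that of the commuting variety cannot be properly contained in a
component.
-/

namespace CommVar

/-! ### Krull dimension of affine domains -/

section CommutativeAlgebra

/-- An injective integral extension preserves the Krull dimension: chains of primes contract to
chains by incomparability, and lift by lying over and going up. -/
theorem ringKrullDim_eq_of_isIntegral {R S : Type*} [CommRing R] [CommRing S] [Algebra R S]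
    [Algebra.IsIntegral R S] (hinj : Function.Injective (algebraMap R S)) :
    ringKrullDim S = ringKrullDim R := by
  refine le_antisymm ?_ (iSup_le fun l => ?_)
  · exact Order.krullDim_le_of_strictMono (PrimeSpectrum.comap (algebraMap R S))
      fun p q h => Ideal.IsIntegral.comap_lt_comap (R := R) h
  · obtain ⟨Q, -, hQ, hQl⟩ := Ideal.exists_ideal_over_prime_of_isIntegral (S := S)
      l.head.asIdeal ⊥ (by
        intro x hx
        have : x = 0 := hinj (by simpa using hx)
        simp [this])
    have : Q.LiesOver l.head.asIdeal := ⟨hQl.symm⟩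
    obtain ⟨L, hL, -⟩ := Ideal.exists_ltSeries_of_hasGoingUp l Q
    rw [← hL]
    exact Order.LTSeries.length_le_krullDim L

/-- The Krull dimension of an affine domain is its transcendence degree: by Noether normalization
both agree with those of a polynomial ring. -/
theorem ringKrullDim_eq_trdeg (k R : Type*) [Field k] [CommRing R] [IsDomain R] [Algebra k R]
    [Algebra.FiniteType k R] :
    ringKrullDim R = (Cardinal.toNat (Algebra.trdeg k R) : WithBot ℕ∞) := by
  obtain ⟨s, f, hf, hint⟩ := exists_integral_inj_algHom_of_fg k R
  let _ : Algebra (MvPolynomial (Fin s) k) R := f.toRingHom.toAlgebra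
  have : IsScalarTower k (MvPolynomial (Fin s) k) R :=
    IsScalarTower.of_algebraMap_eq fun x => (f.commutes x).symm
  have : Algebra.IsIntegral (MvPolynomial (Fin s) k) R := ⟨hint⟩
  have hf' : Function.Injective (algebraMap (MvPolynomial (Fin s) k) R) := hf
  have : FaithfulSMul (MvPolynomial (Fin s) k) R :=
    (faithfulSMul_iff_algebraMap_injective _ _).2 hf'
  rw [ringKrullDim_eq_of_isIntegral hf', MvPolynomial.ringKrullDim_of_isNoetherianRing,
    ringKrullDim_eq_zero_of_field, zero_add]
  have h := lift_trdeg_add_eq k (MvPolynomial (Fin s) k) R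
  rw [MvPolynomial.trdeg_of_isDomain, trdeg_eq_zero, Cardinal.lift_zero, add_zero] at h
  have h2 := congrArg Cardinal.toNat h
  simp only [Cardinal.toNat_lift, Cardinal.mk_fin, Cardinal.toNat_natCast,
    Cardinal.lift_natCast] at h2
  rw [← h2]
  simp

/-- Inverting a non-zero element of an affine domain does not change its fraction field, and hence
not its Krull dimension. -/
theorem ringKrullDim_localizationAway (k : Type*) {R : Type*} [Field k] [CommRing R] [IsDomain R]
    [Algebra k R] [Algebra.FiniteType k R] {f : R} (hf : f ≠ 0) :
    ringKrullDim (Localization.Away f) = ringKrullDim R := by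
  have hM : Submonoid.powers f ≤ nonZeroDivisors R :=
    powers_le_nonZeroDivisors_of_noZeroDivisors hf
  have : IsDomain (Localization.Away f) := IsLocalization.isDomain_localization hM
  have hinj : Function.Injective (algebraMap R (Localization.Away f)) :=
    IsLocalization.injective _ hM
  have : FaithfulSMul R (Localization.Away f) :=
    (faithfulSMul_iff_algebraMap_injective _ _).2 hinj
  have : Algebra.IsAlgebraic R (Localization.Away f) :=
    IsLocalization.isAlgebraic _ (Submonoid.powers f)
  have : IsScalarTower k R (Localization.Away f) := inferInstance
  have : Algebra.FiniteType k (Localization.Away f) := inferInstance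
  rw [ringKrullDim_eq_trdeg k (Localization.Away f), ringKrullDim_eq_trdeg k R,
    ← trdeg_add_eq k R (A := Localization.Away f), trdeg_eq_zero (R := R), add_zero]

/-- The primes avoiding a non-zero element of an affine domain already compute its dimension. -/
theorem ringKrullDim_le_krullDim_primes_not_mem (k : Type*) {R : Type*} [Field k] [CommRing R]
    [IsDomain R] [Algebra k R] [Algebra.FiniteType k R] {f : R} (hf : f ≠ 0) :
    ringKrullDim R ≤ Order.krullDim {p : PrimeSpectrum R // f ∉ p.asIdeal} := by
  rw [← ringKrullDim_localizationAway k hf]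
  let G : PrimeSpectrum (Localization.Away f) → {p : PrimeSpectrum R // f ∉ p.asIdeal} := fun q =>
    ⟨PrimeSpectrum.comap (algebraMap R (Localization.Away f)) q, fun h =>
      q.isPrime.ne_top (Ideal.eq_top_of_isUnit_mem _ h
        (IsLocalization.Away.algebraMap_isUnit f))⟩
  refine Order.krullDim_le_of_strictMono G fun p q h => ?_
  refine Subtype.mk_lt_mk.2 (lt_of_le_of_ne (Ideal.comap_mono h.le) fun h' => h.ne ?_)
  exact PrimeSpectrum.localization_comap_injective _ (Submonoid.powers f) h'

end CommutativeAlgebra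

/-! ### Krull dimension of subspaces -/

section Topology

variable {X : Type*} [TopologicalSpace X]

theorem isIrreducible_image_val_iff {S : Set X} {Z : Set S} :
    IsIrreducible ((↑) '' Z : Set X) ↔ IsIrreducible Z := by
  refine ⟨fun h => ⟨by simpa using h.1, ?_⟩, fun h => h.image _ continuous_subtype_val.continuousOn⟩
  rintro _ _ ⟨U, hU, rfl⟩ ⟨U', hU', rfl⟩ ⟨x, hx, hxU⟩ ⟨y, hy, hyU⟩
  obtain ⟨_, ⟨z, hz, rfl⟩, hzU⟩ := h.2 U U' hU hU' ⟨x, ⟨x, hx, rfl⟩, hxU⟩ ⟨y, ⟨y, hy, rfl⟩, hyU⟩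
  exact ⟨z, hz, hzU⟩

/-- The irreducible relatively closed subsets of `S`, as subsets of the ambient space. -/
abbrev IrrClosedIn (S : Set X) : Type _ :=
  {Z : Set X // IsIrreducible Z ∧ Z ⊆ S ∧ closure Z ∩ S ⊆ Z}

/-- The Krull dimension of a subspace can be computed by chains of subsets of the ambient space. -/
theorem topologicalKrullDim_eq_krullDim_irrClosedIn (S : Set X) :
    topologicalKrullDim S = Order.krullDim (IrrClosedIn S) := by
  apply le_antisymm
  · refine Order.krullDim_le_of_strictMono
      (fun Z => ⟨(↑) '' (Z : Set S), isIrreducible_image_val_iff.2 Z.isIrreducible', by simp, ?_⟩)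
      fun Z W h => ?_
    · rintro x ⟨hx, hxS⟩
      refine ⟨⟨x, hxS⟩, ?_, rfl⟩
      have : closure (Z : Set S) = Z := Z.isClosed'.closure_eq
      have h2 : (⟨x, hxS⟩ : S) ∈ closure (Z : Set S) := by
        rw [closure_subtype]; exact hx
      rw [this] at h2
      exact h2
    · refine lt_of_le_of_ne (Set.image_mono h.le) fun h' => h.ne ?_
      exact SetLike.coe_injective (Subtype.val_injective.image_injective (congrArg Subtype.val h'))
  · refine Order.krullDim_le_of_strictMono (fun Z : IrrClosedIn S => ⟨(↑) ⁻¹' Z.1, ?_, ?_⟩)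
      fun Z W h => ?_
    · rw [← isIrreducible_image_val_iff, Subtype.image_preimage_coe,
        Set.inter_eq_right.2 Z.2.2.1]
      exact Z.2.1
    · refine isClosed_of_closure_subset fun x hx => Z.2.2.2 ⟨?_, x.2⟩
      rw [closure_subtype, Subtype.image_preimage_coe, Set.inter_eq_right.2 Z.2.2.1] at hx
      exact hx
    · refine lt_of_le_of_ne (fun x hx => (show Z.1 ⊆ W.1 from h.le) hx) fun h' => h.ne ?_
      have h3 : ((↑) ⁻¹' Z.1 : Set S) = (↑) ⁻¹' W.1 := congrArg SetLike.coe h'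
      have h4 := congrArg (fun T : Set S => ((↑) '' T : Set X)) h3
      simp only [Subtype.image_preimage_coe, Set.inter_eq_right.2 Z.2.2.1,
        Set.inter_eq_right.2 W.2.2.1] at h4
      exact Subtype.ext h4

theorem topologicalKrullDim_mono {S T : Set X} (h : S ⊆ T) :
    topologicalKrullDim S ≤ topologicalKrullDim T :=
  (Topology.IsEmbedding.inclusion h).isInducing.topologicalKrullDim_le

theorem topologicalKrullDim_ne_bot {S : Set X} (hS : S.Nonempty) : topologicalKrullDim S ≠ ⊥ := by
  have := hS.to_subtype
  have : Nonempty (TopologicalSpace.IrreducibleCloseds S) :=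
    ⟨⟨closure {this.some}, isIrreducible_singleton.closure, isClosed_closure⟩⟩
  exact Order.krullDim_ne_bot_iff.2 this

/-- A non-empty finite-dimensional set has an irreducible component of the same dimension, namely
any component containing the largest member of a longest chain. -/
theorem exists_maximal_irreducible_topologicalKrullDim_eq {S : Set X} (hS : S.Nonempty)
    (hfin : topologicalKrullDim S < ⊤) :
    ∃ Y, Maximal (fun T => T ⊆ S ∧ IsIrreducible T) Y ∧
      topologicalKrullDim Y = topologicalKrullDim S := by
  obtain ⟨n, hn⟩ := WithBot.ne_bot_iff_exists.1 (topologicalKrullDim_ne_bot hS)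
  have hn' : n ≠ ⊤ := by rintro rfl; rw [← hn] at hfin; exact lt_irrefl _ hfin
  obtain ⟨m, rfl⟩ := ENat.ne_top_iff_exists.1 hn'
  have h1 : (m : WithBot ℕ∞) ≤ Order.krullDim (IrrClosedIn S) := by
    rw [← topologicalKrullDim_eq_krullDim_irrClosedIn, ← hn]; rfl
  obtain ⟨l, hl⟩ := Order.le_krullDim_iff.1 h1
  have hlast := l.last.2
  have hlast' : IsIrreducible ((↑) ⁻¹' l.last.1 : Set S) := by
    rw [← isIrreducible_image_val_iff, Subtype.image_preimage_coe, Set.inter_eq_right.2 hlast.2.1]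
    exact hlast.1
  obtain ⟨Y, hY, hlY, hYmax⟩ := exists_preirreducible _ hlast'.2
  have hYirr : IsIrreducible Y := ⟨hlast'.1.mono hlY, hY⟩
  have hsub : l.last.1 ⊆ (↑) '' Y := by
    rw [← Set.inter_eq_right.2 hlast.2.1, ← Subtype.image_preimage_coe]
    exact Set.image_mono hlY
  refine ⟨(↑) '' Y, ⟨⟨by simp, isIrreducible_image_val_iff.2 hYirr⟩, ?_⟩, ?_⟩
  · rintro T ⟨hTS, hT⟩ hYT
    have h2 : ((↑) ⁻¹' T : Set S) = Y := by
      refine hYmax _ ?_ (Set.image_subset_iff.1 hYT)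
      refine (isIrreducible_image_val_iff.1 ?_).2
      rwa [Subtype.image_preimage_coe, Set.inter_eq_right.2 hTS]
    rw [← h2, Subtype.image_preimage_coe, Set.inter_eq_right.2 hTS]
  · refine le_antisymm (topologicalKrullDim_mono (by simp)) ?_
    rw [← hn, topologicalKrullDim_eq_krullDim_irrClosedIn]
    refine Order.le_krullDim_iff.2
      ⟨⟨l.length, fun i => ⟨(l i).1, (l i).2.1, ?_, ?_⟩, fun i => ?_⟩, hl⟩
    · exact (show (l i).1 ⊆ l.last.1 from l.monotone (Fin.le_last i)).trans hsub
    · exact fun x hx => (l i).2.2.2 ⟨hx.1, by obtain ⟨y, -, rfl⟩ := hx.2; exact y.2⟩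
    · exact l.step i

/-- A proper irreducible closed subset of an irreducible closed set `D` of finite dimension has
smaller dimension, since `D` can be appended to every chain in the subset. -/
theorem eq_of_topologicalKrullDim_le {C D : Set X} (hC : IsClosed C) (hD : IsClosed D)
    (hDi : IsIrreducible D) (hCi : IsIrreducible C) (hCD : C ⊆ D)
    (hfin : topologicalKrullDim D < ⊤)
    (hdim : topologicalKrullDim D ≤ topologicalKrullDim C) : C = D := by
  by_contra hne
  have key : topologicalKrullDim C + 1 ≤ topologicalKrullDim D := by
    rw [topologicalKrullDim_eq_krullDim_irrClosedIn, topologicalKrullDim_eq_krullDim_irrClosedIn D]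
    have : Nonempty (IrrClosedIn C) := ⟨⟨C, hCi, subset_rfl, by rw [hC.closure_eq]; simp⟩⟩
    have : Nonempty (IrrClosedIn D) := ⟨⟨D, hDi, subset_rfl, by rw [hD.closure_eq]; simp⟩⟩
    rw [Order.krullDim_eq_iSup_length, Order.krullDim_eq_iSup_length]
    norm_cast
    rw [ENat.iSup_add]
    refine iSup_le fun l => ?_
    let l' : LTSeries (IrrClosedIn D) := l.map (fun Z => ⟨Z.1, Z.2.1, Z.2.2.1.trans hCD, fun x hx =>
      Z.2.2.2 ⟨hx.1, hC.closure_subset_iff.2 Z.2.2.1 hx.1⟩⟩) fun Z W h => h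
    let l'' := l'.snoc ⟨D, hDi, subset_rfl, by simp⟩ (by
      refine lt_of_le_of_ne (show l'.last ≤ _ from l'.last.2.2.1) fun h => hne ?_
      refine subset_antisymm hCD ?_
      have h3 : l'.last.1 = D := congrArg Subtype.val h
      rw [← h3]
      exact l.last.2.2.1)
    refine le_trans (le_of_eq ?_) (le_iSup _ l'')
    rw [RelSeries.snoc_length]
    rfl
  have hfinC : topologicalKrullDim C < ⊤ := (topologicalKrullDim_mono hCD).trans_lt hfin
  obtain ⟨n, hn⟩ := WithBot.ne_bot_iff_exists.1 (topologicalKrullDim_ne_bot hCi.1)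
  have h := key.trans hdim
  rw [← hn] at h hfinC
  have hn' : n ≠ ⊤ := by rintro rfl; exact lt_irrefl _ hfinC
  obtain ⟨m, rfl⟩ := ENat.ne_top_iff_exists.1 hn'
  norm_cast at h
  omega

end Topology

/-! ### Zariski closure, irreducibility and the Nullstellensatz -/

section Zariski
open Topology

variable (k : Type*) [Field k] {V : Type*} [AddCommGroup V] [Module k V]
variable {W : Type*} [AddCommGroup W] [Module k W]

theorem isClosed_zariski_iff {Z : Set V} :
    IsClosed[zariski k V] Z ↔ ∃ P : Set (V → k), P ⊆ polyFun k V ∧ Z = zeros k P := by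
  let _ : TopologicalSpace V := zariski k V
  rw [← isOpen_compl_iff]
  change Zᶜᶜ ∈ _ ↔ _
  rw [compl_compl]
  rfl

theorem isClosed_setOf_eq_zero {p : V → k} (hp : p ∈ polyFun k V) :
    IsClosed[zariski k V] {v | p v = 0} :=
  (isClosed_zariski_iff k).2 ⟨{p}, by simpa using hp, by ext v; simp [zeros]⟩

theorem isOpen_setOf_ne_zero {p : V → k} (hp : p ∈ polyFun k V) :
    IsOpen[zariski k V] {v | p v ≠ 0} := by
  let _ : TopologicalSpace V := zariski k V
  exact (isClosed_setOf_eq_zero k hp).isOpen_compl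

/-- The sets `{p ≠ 0}` form a basis of the Zariski topology. -/
theorem exists_polyFun_of_mem_isOpen {U : Set V} (hU : IsOpen[zariski k V] U) {v : V} (hv : v ∈ U) :
    ∃ p ∈ polyFun k V, p v ≠ 0 ∧ {w | p w ≠ 0} ⊆ U := by
  let _ : TopologicalSpace V := zariski k V
  obtain ⟨P, hP, hPU⟩ := (isClosed_zariski_iff k).1 hU.isClosed_compl
  have hvP : v ∉ zeros k P := by rw [← hPU]; exact fun h => h hv
  simp only [zeros, Set.mem_ofPred_eq, not_forall] at hvP
  obtain ⟨p, hp, hpv⟩ := hvP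
  refine ⟨p, hP hp, hpv, fun w hw => ?_⟩
  by_contra hwU
  have : w ∈ zeros k P := by rw [← hPU]; exact hwU
  exact hw (this p hp)

theorem mem_zclosure {S : Set V} {v : V} :
    v ∈ zclosure k S ↔ ∀ p ∈ polyFun k V, (∀ s ∈ S, p s = 0) → p v = 0 := by
  let _ : TopologicalSpace V := zariski k V
  constructor
  · intro hv p hp hpS
    exact closure_minimal (fun s hs => hpS s hs) (isClosed_setOf_eq_zero k hp) hv
  · intro h
    by_contra hv
    obtain ⟨p, hp, hpv, hpU⟩ := exists_polyFun_of_mem_isOpen k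
      (isClosed_closure (s := S)).isOpen_compl hv
    refine hpv (h p hp fun s hs => ?_)
    by_contra hps
    exact hpU hps (subset_closure hs)

/-- The ideal of the polynomial functions vanishing on `S`. -/
def vanishing (S : Set V) : Ideal (polyFun k V) where
  carrier := {p | ∀ v ∈ S, p.1 v = 0}
  zero_mem' := fun _ _ => rfl
  add_mem' := fun {p q} hp hq v hv => by simp [hp v hv, hq v hv]
  smul_mem' := fun p q hq v hv => by simp [hq v hv]

variable {k} in
theorem mem_vanishing {S : Set V} {p : polyFun k V} :
    p ∈ vanishing k S ↔ ∀ v ∈ S, p.1 v = 0 := Iff.rfl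

theorem vanishing_anti {S T : Set V} (h : S ⊆ T) : vanishing k T ≤ vanishing k S :=
  fun _ hp v hv => hp v (h hv)

theorem mem_zclosure_iff_vanishing {S : Set V} {v : V} :
    v ∈ zclosure k S ↔ ∀ p ∈ vanishing k S, p.1 v = 0 := by
  rw [mem_zclosure]
  exact ⟨fun h p hp => h p.1 p.2 hp, fun h p hp hpS => h ⟨p, hp⟩ hpS⟩

theorem subset_zclosure (S : Set V) : S ⊆ zclosure k S :=
  @subset_closure _ (zariski k V) S

theorem vanishing_zclosure (S : Set V) : vanishing k (zclosure k S) = vanishing k S :=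
  le_antisymm (vanishing_anti k (subset_zclosure k S))
    fun p hp _ hv => (mem_zclosure_iff_vanishing k).1 hv p hp

theorem zclosure_eq_of_vanishing_eq {S T : Set V} (h : vanishing k S = vanishing k T) :
    zclosure k S = zclosure k T := by
  ext v
  rw [mem_zclosure_iff_vanishing, mem_zclosure_iff_vanishing, h]

/-- A set is irreducible if and only if its vanishing ideal is prime. -/
theorem zIrreducible_iff_isPrime {S : Set V} : ZIrreducible k S ↔ (vanishing k S).IsPrime := by
  let _ : TopologicalSpace V := zariski k V
  constructor
  · intro hS
    refine ⟨?_, ?_⟩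
    · intro htop
      obtain ⟨v, hv⟩ := hS.1
      have : (1 : polyFun k V) ∈ vanishing k S := htop ▸ Submodule.mem_top
      simpa using this v hv
    · intro p q hpq
      by_contra! hcon
      simp only [mem_vanishing, not_forall] at hcon
      obtain ⟨⟨v, hv, hpv⟩, w, hw, hqw⟩ := hcon
      obtain ⟨z, hz, h1, h2⟩ := hS.2 _ _ (isOpen_setOf_ne_zero k p.2) (isOpen_setOf_ne_zero k q.2)
        ⟨v, hv, hpv⟩ ⟨w, hw, hqw⟩
      exact (mul_ne_zero h1 h2) (hpq z hz)
  · intro hS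
    refine ⟨?_, ?_⟩
    · by_contra hne
      rw [Set.not_nonempty_iff_eq_empty] at hne
      subst hne
      exact hS.ne_top ((Ideal.eq_top_iff_one _).2 fun v hv => hv.elim)
    · rintro U U' hU hU' ⟨v, hv, hvU⟩ ⟨w, hw, hwU⟩
      obtain ⟨p, hp, hpv, hpU⟩ := exists_polyFun_of_mem_isOpen k hU hvU
      obtain ⟨q, hq, hqw, hqU⟩ := exists_polyFun_of_mem_isOpen k hU' hwU
      have h : (⟨p, hp⟩ * ⟨q, hq⟩ : polyFun k V) ∉ vanishing k S := fun h =>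
        (hS.mem_or_mem h).elim (fun h => hpv (h v hv)) (fun h => hqw (h w hw))
      simp only [mem_vanishing, not_forall] at h
      obtain ⟨z, hz, hpq⟩ := h
      have hpq' : p z * q z ≠ 0 := hpq
      exact ⟨z, hz, hpU (left_ne_zero_of_mul hpq'), hqU (right_ne_zero_of_mul hpq')⟩

theorem linear_mem_polyFun (φ : Module.Dual k V) : (φ : V → k) ∈ polyFun k V :=
  Algebra.subset_adjoin ⟨φ, rfl⟩

instance [FiniteDimensional k V] : Algebra.FiniteType k (polyFun k V) := by
  classical
  let b := Module.finBasis k V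
  refine (Subalgebra.fg_iff_finiteType _).1 ⟨Finset.univ.image fun i => (b.coord i : V → k), ?_⟩
  refine le_antisymm (Algebra.adjoin_mono ?_) (Algebra.adjoin_le ?_)
  · intro p hp
    obtain ⟨i, -, rfl⟩ := Finset.mem_image.1 (Finset.mem_coe.1 hp)
    exact ⟨b.coord i, rfl⟩
  · rintro _ ⟨φ, rfl⟩
    have hφ : (φ : V → k) = ∑ i, φ (b i) • (b.coord i : V → k) := by
      funext v
      conv_lhs => rw [← b.sum_repr v]
      simp only [map_sum, map_smul, smul_eq_mul, Finset.sum_apply, Pi.smul_apply,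
        Module.Basis.coord_apply, mul_comm]
    change (φ : V → k) ∈ _
    rw [hφ]
    refine Subalgebra.sum_mem _ fun i _ => Subalgebra.smul_mem _ (Algebra.subset_adjoin ?_) _
    simp

/-- A character of the algebra of polynomial functions is the evaluation at a point, because a
finite-dimensional vector space is its own double dual. -/
theorem exists_eval_eq [FiniteDimensional k V] (χ : polyFun k V →ₐ[k] k) :
    ∃ v : V, ∀ p, χ p = p.1 v := by
  let ξ : Module.Dual k (Module.Dual k V) :=
    { toFun := fun φ => χ ⟨φ, linear_mem_polyFun k φ⟩
      map_add' := fun φ ψ => by rw [← map_add]; rfl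
      map_smul' := fun c φ => by rw [RingHom.id_apply, ← map_smul]; rfl }
  obtain ⟨v, hv⟩ := (Module.evalEquiv k V).surjective ξ
  refine ⟨v, ?_⟩
  rintro ⟨p, hp⟩
  induction hp using Algebra.adjoin_induction with
  | mem p hp =>
    obtain ⟨φ, rfl⟩ := hp
    exact (congrArg (fun η : Module.Dual k (Module.Dual k V) => η φ) hv).symm
  | algebraMap r => exact χ.commutes r
  | add p q hp hq hp' hq' =>
    have := map_add χ ⟨p, hp⟩ ⟨q, hq⟩
    rw [hp', hq'] at this
    exact this
  | mul p q hp hq hp' hq' =>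
    have := map_mul χ ⟨p, hp⟩ ⟨q, hq⟩
    rw [hp', hq'] at this
    exact this

/-- **Hilbert's Nullstellensatz** for polynomial functions on a finite-dimensional space. -/
theorem exists_point_of_not_mem_prime [IsAlgClosed k] [FiniteDimensional k V]
    {P : Ideal (polyFun k V)} (hP : P.IsPrime) {p : polyFun k V} (hp : p ∉ P) :
    ∃ v : V, (∀ q ∈ P, q.1 v = 0) ∧ p.1 v ≠ 0 := by
  have hJ : IsJacobsonRing (polyFun k V) := isJacobsonRing_of_finiteType (A := k)
  rw [← isJacobsonRing_iff_prime_eq.1 hJ P hP, Ideal.jacobson, Ideal.mem_sInf] at hp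
  push Not at hp
  obtain ⟨M, ⟨hPM, hM⟩, hpM⟩ := hp
  let _ : Field (polyFun k V ⧸ M) := Ideal.Quotient.field M
  have : Module.Finite k (polyFun k V ⧸ M) := finite_of_finite_type_of_isJacobsonRing k _
  have : Algebra.IsIntegral k (polyFun k V ⧸ M) := Algebra.IsIntegral.of_finite k _
  have hbij : Function.Bijective (algebraMap k (polyFun k V ⧸ M)) :=
    IsAlgClosed.algebraMap_bijective_of_isIntegral
  let e : k ≃ₐ[k] (polyFun k V ⧸ M) := AlgEquiv.ofBijective (Algebra.ofId _ _) hbij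
  obtain ⟨v, hv⟩ := exists_eval_eq k (e.symm.toAlgHom.comp (Ideal.Quotient.mkₐ k M))
  have hmem : ∀ q : polyFun k V, q ∈ M ↔ q.1 v = 0 := fun q => by
    rw [← hv q, ← Ideal.Quotient.eq_zero_iff_mem]
    exact (map_eq_zero_iff e.symm e.symm.injective).symm
  exact ⟨v, fun q hq => (hmem q).1 (hPM hq), fun h => hpM ((hmem p).2 h)⟩

/-- The coordinate ring of the closure of `S`. -/
abbrev coordRing (S : Set V) : Type _ := polyFun k V ⧸ vanishing k S

/-- The dimension of any set is at most that of its coordinate ring, because relatively closed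
irreducible subsets are determined by their vanishing ideals. -/
theorem topologicalKrullDim_le_ringKrullDim (S : Set V) :
    @topologicalKrullDim S (@instTopologicalSpaceSubtype _ _ (zariski k V)) ≤
      ringKrullDim (coordRing k S) := by
  let _ : TopologicalSpace V := zariski k V
  rw [topologicalKrullDim_eq_krullDim_irrClosedIn, ringKrullDim_quotient,
    ← Order.krullDim_orderDual (α := PrimeSpectrum.zeroLocus _)]
  have hpr : ∀ Z : IrrClosedIn S, (vanishing k Z.1).IsPrime := fun Z =>
    (zIrreducible_iff_isPrime k).1 Z.2.1
  refine Order.krullDim_le_of_strictMono (fun Z : IrrClosedIn S => OrderDual.toDual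
    ⟨⟨vanishing k Z.1, hpr Z⟩, vanishing_anti k Z.2.2.1⟩) fun Z T h => ?_
  refine lt_of_le_of_ne (vanishing_anti k h.le) fun h' => h.ne (Subtype.ext ?_)
  have h1 : vanishing k Z.1 = vanishing k T.1 :=
    congrArg (fun q => (OrderDual.ofDual q).1.asIdeal) h'
  have h2 := zclosure_eq_of_vanishing_eq k h1
  refine subset_antisymm (show Z.1 ⊆ T.1 from h.le) fun t ht => Z.2.2.2 ⟨?_, T.2.2.1 ht⟩
  change t ∈ zclosure k Z.1
  rw [h2]
  exact subset_zclosure k _ ht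

/-- The dimension of an irreducible locally closed set is the Krull dimension of its coordinate
ring. The set contains a basic open subset `{f ≠ 0}` of its closure; the Nullstellensatz turns the
chains of primes not containing `f` into chains of irreducible subsets. -/
theorem topologicalKrullDim_eq_ringKrullDim [IsAlgClosed k] [FiniteDimensional k V] {S : Set V}
    (hS : ZIrreducible k S) (hloc : @IsLocallyClosed V (zariski k V) S) :
    @topologicalKrullDim S (@instTopologicalSpaceSubtype _ _ (zariski k V)) =
      ringKrullDim (coordRing k S) := by
  let _ : TopologicalSpace V := zariski k V
  refine le_antisymm (topologicalKrullDim_le_ringKrullDim k S) ?_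
  have hprime := (zIrreducible_iff_isPrime k).1 hS
  obtain ⟨s, hs⟩ := hS.1
  obtain ⟨U, Z, hU, hZ, rfl⟩ := hloc
  obtain ⟨f, hf, hfs, hfU⟩ := exists_polyFun_of_mem_isOpen k hU hs.1
  set S := U ∩ Z
  have : IsDomain (coordRing k S) := Ideal.Quotient.isDomain _
  have hfne : (Ideal.Quotient.mk (vanishing k S) ⟨f, hf⟩ : coordRing k S) ≠ 0 := fun h =>
    hfs (Ideal.Quotient.eq_zero_iff_mem.1 h s hs)
  refine (ringKrullDim_le_krullDim_primes_not_mem k (R := coordRing k S) hfne).trans ?_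
  rw [topologicalKrullDim_eq_krullDim_irrClosedIn, ← Order.krullDim_orderDual (α := IrrClosedIn _)]
  -- the zero locus of a prime in `S`
  let N : PrimeSpectrum (coordRing k S) → Set V := fun q =>
    {v | v ∈ S ∧ ∀ p : polyFun k V, Ideal.Quotient.mk _ p ∈ q.asIdeal → p.1 v = 0}
  have hN : ∀ q : PrimeSpectrum (coordRing k S), Ideal.Quotient.mk _ ⟨f, hf⟩ ∉ q.asIdeal →
      vanishing k (N q) = q.asIdeal.comap (Ideal.Quotient.mk _) := by
    intro q hq
    have hqp : (q.asIdeal.comap (Ideal.Quotient.mk (vanishing k S))).IsPrime := inferInstance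
    refine le_antisymm (fun p hp => ?_) fun p hp v hv => hv.2 p hp
    by_contra hpq
    obtain ⟨v, hv, hv'⟩ := exists_point_of_not_mem_prime k hqp (p := ⟨f, hf⟩ * p)
      fun h => (hqp.mem_or_mem h).elim hq hpq
    have hv'' : f v * p.1 v ≠ 0 := hv'
    refine right_ne_zero_of_mul hv''
      (hp v ⟨⟨hfU (left_ne_zero_of_mul hv''), ?_⟩, fun r hr => hv r hr⟩)
    have : v ∈ zclosure k S := (mem_zclosure_iff_vanishing k).2 fun r hr => hv r (by
      rw [Ideal.mem_comap, Ideal.Quotient.eq_zero_iff_mem.2 hr]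
      exact zero_mem _)
    exact hZ.closure_subset_iff.2 Set.inter_subset_right this
  refine Order.krullDim_le_of_strictMono
    (fun q => OrderDual.toDual ⟨N q.1, ?_, fun v hv => hv.1, ?_⟩)
    fun q q' h => ?_
  · refine (zIrreducible_iff_isPrime k).2 ?_
    rw [hN q.1 q.2]
    infer_instance
  · rintro v ⟨hv, hvS⟩
    refine ⟨hvS, fun p hp => ?_⟩
    exact (mem_zclosure k).1 hv p.1 p.2 fun w hw => hw.2 p hp
  · refine lt_of_le_of_ne ?_ fun h' => h.ne ?_
    · exact fun v hv => ⟨hv.1, fun p hp => hv.2 p (h.le hp)⟩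
    · have h1 : N q.1 = N q'.1 := congrArg (fun Z => (OrderDual.ofDual Z).1) h'
      have h2 := hN q.1 q.2
      rw [h1, hN q'.1 q'.2] at h2
      exact Subtype.ext (PrimeSpectrum.ext
        (Ideal.comap_injective_of_surjective _ Ideal.Quotient.mk_surjective h2.symm))

end Zariski

/-! ### Products with affine space -/

/-- If an ideal of `B` corresponds, under a surjection `A[X] → B`, to the polynomials with
coefficients in `I`, then the quotient of `B` is a polynomial ring over `A / I`. -/
noncomputable def quotientMvPolynomialEquiv {A B σ : Type*} [CommRing A] [CommRing B] {I : Ideal A}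
    {J : Ideal B} (θ : MvPolynomial σ A →+* B) (hθ : Function.Surjective θ)
    (h : ∀ F, θ F ∈ J ↔ ∀ m, MvPolynomial.coeff m F ∈ I) : MvPolynomial σ (A ⧸ I) ≃+* B ⧸ J :=
  ((MvPolynomial.quotientEquivQuotientMvPolynomial I).toRingEquiv.trans
    (Ideal.quotEquivOfEq (by
      ext F
      rw [MvPolynomial.mem_map_C_iff, RingHom.mem_ker, RingHom.comp_apply,
        Ideal.Quotient.eq_zero_iff_mem, h]))).trans
  (RingHom.quotientKerEquivOfSurjective (f := (Ideal.Quotient.mk J).comp θ)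
    (Ideal.Quotient.mk_surjective.comp hθ))

section Product
open Topology

variable (k : Type*) [Field k] {V : Type*} [AddCommGroup V] [Module k V]
variable {W : Type*} [AddCommGroup W] [Module k W]

/-- Polynomial functions pull back along maps with polynomial coordinates. -/
theorem comp_mem_polyFun {f : V → W} (hf : ∀ φ : Module.Dual k W, (fun v => φ (f v)) ∈ polyFun k V)
    {p : W → k} (hp : p ∈ polyFun k W) : (fun v => p (f v)) ∈ polyFun k V := by
  induction hp using Algebra.adjoin_induction with
  | mem p hp => obtain ⟨φ, rfl⟩ := hp; exact hf φ
  | algebraMap r => exact (polyFun k V).algebraMap_mem r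
  | add p q _ _ hp' hq' => exact add_mem hp' hq'
  | mul p q _ _ hp' hq' => exact mul_mem hp' hq'

theorem comp_linear_mem_polyFun (f : V →ₗ[k] W) {p : W → k} (hp : p ∈ polyFun k W) :
    (fun v => p (f v)) ∈ polyFun k V :=
  comp_mem_polyFun k (fun φ => linear_mem_polyFun k (φ.comp f)) hp

/-- Pullback of polynomial functions along a linear map. -/
def pullback (f : V →ₗ[k] W) : polyFun k W →+* polyFun k V where
  toFun p := ⟨fun v => p.1 (f v), comp_linear_mem_polyFun k f p.2⟩
  map_one' := rfl
  map_mul' _ _ := rfl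
  map_zero' := rfl
  map_add' _ _ := rfl

/-- A polynomial in `r` variables over `k[V]`, as a polynomial function on `V × k^r`. -/
noncomputable def mvPolynomialToPolyFun (V : Type*) [AddCommGroup V] [Module k V] (r : ℕ) :
    MvPolynomial (Fin r) (polyFun k V) →+* polyFun k (V × (Fin r → k)) :=
  MvPolynomial.eval₂Hom (pullback k (LinearMap.fst k V _))
    fun i => ⟨fun z => z.2 i, linear_mem_polyFun k
      (LinearMap.proj i ∘ₗ LinearMap.snd k V (Fin r → k) : Module.Dual k (V × (Fin r → k)))⟩

/-- Evaluation of polynomial functions at a point. -/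
def evalPoint (v : V) : polyFun k V →+* k := (Pi.evalRingHom _ v).comp (polyFun k V).val.toRingHom

theorem mvPolynomialToPolyFun_apply {r : ℕ} (F : MvPolynomial (Fin r) (polyFun k V))
    (v : V) (c : Fin r → k) :
    (mvPolynomialToPolyFun k V r F).1 (v, c) =
      MvPolynomial.eval c (MvPolynomial.map (evalPoint k v) F) := by
  change ((evalPoint k (v, c)).comp (mvPolynomialToPolyFun k V r)) F =
    ((MvPolynomial.eval c).comp (MvPolynomial.map (evalPoint k v))) F
  congr 1
  refine MvPolynomial.ringHom_ext (fun p => ?_) fun i => ?_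
  · simp [mvPolynomialToPolyFun, evalPoint, pullback]
  · simp [mvPolynomialToPolyFun, evalPoint]

theorem mvPolynomialToPolyFun_surjective (r : ℕ) :
    Function.Surjective (mvPolynomialToPolyFun k V r) := by
  rintro ⟨p, hp⟩
  induction hp using Algebra.adjoin_induction with
  | mem p hp =>
    obtain ⟨φ, rfl⟩ := hp
    refine ⟨MvPolynomial.C ⟨_, linear_mem_polyFun k (φ ∘ₗ LinearMap.inl k V (Fin r → k))⟩ +
      ∑ i, MvPolynomial.C (algebraMap k _ (φ (0, Pi.single i 1))) * MvPolynomial.X i,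
      Subtype.ext (funext fun ⟨v, c⟩ => ?_)⟩
    rw [mvPolynomialToPolyFun_apply]
    have h : φ (v, c) = φ (v, 0) + ∑ i, φ (0, Pi.single i 1) * c i := by
      have h1 : (v, c) = (v, 0) + LinearMap.inr k V _ c := by simp
      have h2 := (φ ∘ₗ LinearMap.inr k V (Fin r → k)).pi_apply_eq_sum_univ c
      rw [h1, map_add]
      congr 1
      refine h2.trans (Finset.sum_congr rfl fun i _ => ?_)
      rw [smul_eq_mul, mul_comm]
      congr 1
      change φ (0, _) = _
      congr 2
      funext j
      simp [Pi.single_apply, eq_comm]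
    simp only [map_add, map_sum, map_mul, MvPolynomial.map_C, MvPolynomial.map_X,
      MvPolynomial.eval_C, MvPolynomial.eval_X]
    exact h.symm
  | algebraMap r =>
    refine ⟨MvPolynomial.C (algebraMap k _ r), Subtype.ext (funext fun ⟨v, c⟩ => ?_)⟩
    rw [mvPolynomialToPolyFun_apply, MvPolynomial.map_C, MvPolynomial.eval_C]
    rfl
  | add p q hp hq hp' hq' =>
    obtain ⟨F, hF⟩ := hp'
    obtain ⟨G, hG⟩ := hq'
    exact ⟨F + G, by rw [map_add, hF, hG]; rfl⟩
  | mul p q hp hq hp' hq' =>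
    obtain ⟨F, hF⟩ := hp'
    obtain ⟨G, hG⟩ := hq'
    exact ⟨F * G, by rw [map_mul, hF, hG]; rfl⟩

/-- The coordinate ring of `Y × k^r` is a polynomial ring over the coordinate ring of `Y`. -/
noncomputable def coordRingProdEquiv [Infinite k] (Y : Set V) (r : ℕ) :
    MvPolynomial (Fin r) (coordRing k Y) ≃+*
      coordRing k (Y ×ˢ Set.univ : Set (V × (Fin r → k))) :=
  quotientMvPolynomialEquiv (mvPolynomialToPolyFun k V r)
    (mvPolynomialToPolyFun_surjective k r) <| by
    intro F
    constructor
    · intro hF m v hv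
      have : MvPolynomial.map (evalPoint k v) F = 0 := MvPolynomial.funext fun c => by
        rw [← mvPolynomialToPolyFun_apply, map_zero]
        exact hF (v, c) ⟨hv, trivial⟩
      have h := congrArg (MvPolynomial.coeff m) this
      rwa [MvPolynomial.coeff_map] at h
    · rintro hF ⟨v, c⟩ ⟨hv, -⟩
      rw [mvPolynomialToPolyFun_apply]
      have : MvPolynomial.map (evalPoint k v) F = 0 := by
        ext m
        rw [MvPolynomial.coeff_map]
        exact hF m v hv
      rw [this, map_zero]

theorem zIrreducible_prod_univ [Infinite k] {Y : Set V} (hY : ZIrreducible k Y) (r : ℕ) :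
    ZIrreducible k (Y ×ˢ Set.univ : Set (V × (Fin r → k))) := by
  rw [zIrreducible_iff_isPrime] at hY ⊢
  have : IsDomain (coordRing k Y) := Ideal.Quotient.isDomain _
  rw [← Ideal.Quotient.isDomain_iff_prime]
  exact (coordRingProdEquiv k Y r).symm.toMulEquiv.isDomain (MvPolynomial (Fin r) (coordRing k Y))

theorem ringKrullDim_coordRing_prod [Infinite k] [FiniteDimensional k V] (Y : Set V) (r : ℕ) :
    ringKrullDim (coordRing k (Y ×ˢ Set.univ : Set (V × (Fin r → k)))) =
      ringKrullDim (coordRing k Y) + r := by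
  have : IsNoetherianRing (coordRing k Y) := Algebra.FiniteType.isNoetherianRing k (coordRing k Y)
  rw [← ringKrullDim_eq_of_ringEquiv (coordRingProdEquiv k Y r)]
  refine (MvPolynomial.ringKrullDim_of_isNoetherianRing (R := coordRing k Y) (ι := Fin r)).trans ?_
  rw [Nat.card_fin]

end Product

/-! ### Morphisms are continuous -/

theorem topologicalKrullDim_eq_of_invOn {X Y : Type*} [TopologicalSpace X] [TopologicalSpace Y]
    {S : Set X} {T : Set Y} {f : X → Y} {g : Y → X} (hf : ContinuousOn f S) (hg : ContinuousOn g T)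
    (hfS : Set.MapsTo f S T) (hgT : Set.MapsTo g T S) (h : Set.InvOn g f S T) :
    topologicalKrullDim S = topologicalKrullDim T := by
  let e : S ≃ₜ T :=
    { toFun := hfS.restrict
      invFun := hgT.restrict
      left_inv := fun x => Subtype.ext (h.1 x.2)
      right_inv := fun y => Subtype.ext (h.2 y.2)
      continuous_toFun := hf.mapsToRestrict hfS
      continuous_invFun := hg.mapsToRestrict hgT }
  exact IsHomeomorph.topologicalKrullDim_eq e e.isHomeomorph

section Morphism
open Topology

variable (k : Type*) [Field k] {V : Type*} [AddCommGroup V] [Module k V]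
variable {W : Type*} [AddCommGroup W] [Module k W]

theorem regularOn_of_mem_polyFun {p : V → k} (hp : p ∈ polyFun k V) (S : Set V) :
    RegularOn k p S :=
  fun _ _ => ⟨p, hp, 1, one_mem _, one_ne_zero, fun y _ _ => (div_one (p y)).symm⟩

variable {k}

theorem RegularOn.add {f g : V → k} {S : Set V} (hf : RegularOn k f S) (hg : RegularOn k g S) :
    RegularOn k (f + g) S := by
  intro x hx
  obtain ⟨p, hp, q, hq, hqx, h⟩ := hf x hx
  obtain ⟨p', hp', q', hq', hqx', h'⟩ := hg x hx
  refine ⟨p * q' + q * p', add_mem (mul_mem hp hq') (mul_mem hq hp'), q * q', mul_mem hq hq',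
    mul_ne_zero hqx hqx', fun y hy hqy => ?_⟩
  have h1 : q y ≠ 0 := left_ne_zero_of_mul hqy
  have h2 : q' y ≠ 0 := right_ne_zero_of_mul hqy
  rw [Pi.add_apply, h y hy h1, h' y hy h2, div_add_div _ _ h1 h2]
  rfl

theorem RegularOn.mul {f g : V → k} {S : Set V} (hf : RegularOn k f S) (hg : RegularOn k g S) :
    RegularOn k (f * g) S := by
  intro x hx
  obtain ⟨p, hp, q, hq, hqx, h⟩ := hf x hx
  obtain ⟨p', hp', q', hq', hqx', h'⟩ := hg x hx
  refine ⟨p * p', mul_mem hp hp', q * q', mul_mem hq hq', mul_ne_zero hqx hqx', fun y hy hqy => ?_⟩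
  rw [Pi.mul_apply, h y hy (left_ne_zero_of_mul hqy), h' y hy (right_ne_zero_of_mul hqy),
    div_mul_div_comm]
  rfl

theorem MorphismOn.regularOn_comp {f : V → W} {S : Set V} (hf : MorphismOn k f S) {p : W → k}
    (hp : p ∈ polyFun k W) : RegularOn k (fun v => p (f v)) S := by
  induction hp using Algebra.adjoin_induction with
  | mem p hp => obtain ⟨φ, rfl⟩ := hp; exact hf φ
  | algebraMap r => exact regularOn_of_mem_polyFun k ((polyFun k V).algebraMap_mem r) S
  | add p q _ _ hp' hq' => exact hp'.add hq'
  | mul p q _ _ hp' hq' => exact hp'.mul hq'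

/-- A morphism pulls polynomial functions back to quotients of polynomial functions, so it pulls
basic open sets back to open sets. -/
theorem MorphismOn.continuousOn {f : V → W} {S : Set V} (hf : MorphismOn k f S) :
    @ContinuousOn V W (zariski k V) (zariski k W) f S := by
  let _ : TopologicalSpace V := zariski k V
  let _ : TopologicalSpace W := zariski k W
  intro x hx N hN
  obtain ⟨O, hON, hO, hxO⟩ := mem_nhds_iff.1 hN
  obtain ⟨p, hp, hpx, hpO⟩ := exists_polyFun_of_mem_isOpen k hO hxO
  obtain ⟨a, ha, b, hb, hbx, hab⟩ := hf.regularOn_comp hp x hx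
  beta_reduce at hab
  have hax : a x ≠ 0 := fun h => hpx (by rw [hab x hx hbx, h, zero_div])
  refine mem_nhdsWithin.2 ⟨_, isOpen_setOf_ne_zero k (mul_mem ha hb), mul_ne_zero hax hbx, ?_⟩
  rintro y ⟨hy, hyS⟩
  have hy' : a y * b y ≠ 0 := hy
  refine hON (hpO (?_ : p (f y) ≠ 0))
  rw [hab y hyS (right_ne_zero_of_mul hy')]
  exact div_ne_zero (left_ne_zero_of_mul hy') (right_ne_zero_of_mul hy')

/-- Maps with polynomial coordinates are continuous. -/
theorem continuous_of_mem_polyFun {f : V → W}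
    (hf : ∀ φ : Module.Dual k W, (fun v => φ (f v)) ∈ polyFun k V) :
    Continuous[zariski k V, zariski k W] f := by
  let _ : TopologicalSpace V := zariski k V
  let _ : TopologicalSpace W := zariski k W
  rw [← continuousOn_univ]
  exact MorphismOn.continuousOn fun φ => regularOn_of_mem_polyFun k (hf φ) _

theorem continuous_zariski_linear (f : V →ₗ[k] W) : Continuous[zariski k V, zariski k W] f :=
  continuous_of_mem_polyFun fun φ => linear_mem_polyFun k (φ.comp f)

theorem continuous_zariski_prodMk {f : V → W} {Z : Type*} [AddCommGroup Z] [Module k Z] {h : V → Z}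
    (hf : ∀ φ : Module.Dual k W, (fun v => φ (f v)) ∈ polyFun k V)
    (hh : ∀ φ : Module.Dual k Z, (fun v => φ (h v)) ∈ polyFun k V) :
    Continuous[zariski k V, zariski k (W × Z)] fun v => (f v, h v) := by
  refine continuous_of_mem_polyFun fun φ => ?_
  have : (fun v => φ (f v, h v)) =
      (fun v => (φ ∘ₗ LinearMap.inl k W Z) (f v)) + fun v => (φ ∘ₗ LinearMap.inr k W Z) (h v) := by
    funext v
    simp [← map_add]
  rw [this]
  exact add_mem (hf _) (hh _)

theorem const_mem_polyFun (c : k) : (fun _ : V => c) ∈ polyFun k V :=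
  (polyFun k V).algebraMap_mem c

/-- A non-empty open subset of an irreducible set is dense in it. -/
theorem vanishing_inter_isOpen {S U : Set V} (hS : ZIrreducible k S) (hU : IsOpen[zariski k V] U)
    (h : (S ∩ U).Nonempty) : vanishing k (S ∩ U) = vanishing k S := by
  refine le_antisymm (fun p hp v hv => ?_) (vanishing_anti k Set.inter_subset_left)
  by_contra hpv
  obtain ⟨w, hw, hpw, hwU⟩ := hS.2 _ _ (isOpen_setOf_ne_zero k p.2) hU ⟨v, hv, hpv⟩ h
  exact hpw (hp w ⟨hw, hwU⟩)

end Morphism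

/-! ### Kernels of linear families of linear maps -/

section Rank
open Topology

variable {k : Type*} [Field k] {V : Type*} [AddCommGroup V] [Module k V]
variable {W : Type*} [AddCommGroup W] [Module k W] {W' : Type*} [AddCommGroup W'] [Module k W']

theorem exists_generalizedInverse (f : W →ₗ[k] W') : ∃ q : W' →ₗ[k] W, ∀ w, f (q (f w)) = f w := by
  obtain ⟨s, hs⟩ := f.rangeRestrict.exists_rightInverse_of_surjective f.range_rangeRestrict
  obtain ⟨q, hq⟩ := s.exists_extend
  refine ⟨q, fun w => ?_⟩
  have h1 : q (f w) = s (f.rangeRestrict w) := LinearMap.congr_fun hq (f.rangeRestrict w)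
  rw [h1]
  exact congrArg Subtype.val (LinearMap.congr_fun hs (f.rangeRestrict w))

/-- The part of `{(x, w) | ρ x w = 0}` over `X`, for a linear family `ρ` of linear maps. -/
def kernelFamily (ρ : V →ₗ[k] W →ₗ[k] W') (X : Set V) : Set (V × W) :=
  {z | ρ z.1 z.2 = 0 ∧ z.1 ∈ X}

/-- Near `x₀` the ranks of the maps of a linear family `ρ` do not drop, and over the points with
the same rank as `x₀` the kernels form a trivial bundle. With a generalized inverse `q` of `ρ x₀`,
the endomorphism `A x = 1 + q ∘ ρ (x - x₀)` is invertible near `x₀`; it sends the kernel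
of `ρ x` into that of `ρ x₀`, bijectively if the ranks agree. -/
theorem exists_isTrivialisation_kernelFamily [FiniteDimensional k W]
    (ρ : V →ₗ[k] W →ₗ[k] W') (x₀ : V) :
    ∃ U : Set V, IsOpen[zariski k V] U ∧ x₀ ∈ U ∧
      (∀ x ∈ U, Module.finrank k (LinearMap.range (ρ x₀)) ≤
        Module.finrank k (LinearMap.range (ρ x))) ∧
      ∀ r, r + Module.finrank k (LinearMap.range (ρ x₀)) = Module.finrank k W → ∃ Φ Ψ, ∀ X : Set V,
        (∀ x ∈ X, Module.finrank k (LinearMap.range (ρ x)) =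
          Module.finrank k (LinearMap.range (ρ x₀))) →
        IsTrivialisation k (kernelFamily ρ X) X U r Φ Ψ := by
  classical
  obtain ⟨q, hq⟩ := exists_generalizedInverse (ρ x₀)
  let A : V → (W →ₗ[k] W) := fun x => LinearMap.id + q ∘ₗ ρ (x - x₀)
  let b := Module.finBasis k W
  let ι := Fin (Module.finrank k W)
  -- the matrix of `A x`, with polynomial functions of `x` as entries
  let M : Matrix ι ι (polyFun k V) := fun i j =>
    ⟨fun x => b.coord i (A x (b j)), by
      have : (fun x => b.coord i (A x (b j))) =
          (fun _ => b.coord i (b j) - b.coord i (q (ρ x₀ (b j)))) +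
            ((b.coord i ∘ₗ q ∘ₗ ρ.flip (b j) : Module.Dual k V) : V → k) := by
        funext x
        simp [A]
        ring
      rw [this]
      exact add_mem (const_mem_polyFun _) (linear_mem_polyFun k _)⟩
  have hM : ∀ x, (evalPoint k x).mapMatrix M = LinearMap.toMatrix b b (A x) := by
    intro x
    ext i j
    rw [LinearMap.toMatrix_apply]
    rfl
  have hdet : ∀ x, M.det.1 x = LinearMap.det (A x) := by
    intro x
    rw [← LinearMap.det_toMatrix b, ← hM, ← RingHom.map_det]
    rfl
  -- the inverse of `A x` by Cramer's rule
  let B : V → (W →ₗ[k] W) := fun x =>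
    (M.det.1 x)⁻¹ • Matrix.toLin b b ((evalPoint k x).mapMatrix M.adjugate)
  have hBA : ∀ x, M.det.1 x ≠ 0 → ∀ w, B x (A x w) = w := by
    intro x hx w
    have h1 : Matrix.toLin b b ((evalPoint k x).mapMatrix M.adjugate) ∘ₗ A x =
        M.det.1 x • LinearMap.id := by
      conv_lhs => rw [← Matrix.toLin_toMatrix b b (A x)]
      rw [← Matrix.toLin_mul, ← hM, ← map_mul, Matrix.adjugate_mul, RingHom.mapMatrix_apply]
      rw [← Matrix.toLin_one b, ← map_smul]
      congr 1
      ext i j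
      by_cases h : i = j
      · subst h; simp [evalPoint]
      · simp [h]
    have h2 := LinearMap.congr_fun h1 w
    simp only [LinearMap.comp_apply, LinearMap.smul_apply, LinearMap.id_apply] at h2
    simp only [B, LinearMap.smul_apply, h2, smul_smul, inv_mul_cancel₀ hx, one_smul]
  have hA : ∀ x w, ρ x w = 0 → ρ x₀ (A x w) = 0 := by
    intro x w hw
    simp [A, hw, hq]
  have hA' : ∀ x w, ρ x w = 0 → A x w = w - q (ρ x₀ w) := by
    intro x w hw
    simp [A, hw, sub_eq_add_neg]
  have hinj : ∀ x, M.det.1 x ≠ 0 → Function.Injective (A x) := fun x hx =>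
    Function.LeftInverse.injective (hBA x hx)
  let AK : ∀ x, LinearMap.ker (ρ x) →ₗ[k] LinearMap.ker (ρ x₀) := fun x =>
    (A x).restrict (fun w hw => hA x w hw)
  have hAK : ∀ x, M.det.1 x ≠ 0 → Function.Injective (AK x) := fun x hx w w' h =>
    Subtype.ext (hinj x hx (congrArg Subtype.val h))
  have hx₀ : M.det.1 x₀ ≠ 0 := by
    rw [hdet]
    simp [A]
  refine ⟨{x | M.det.1 x ≠ 0}, isOpen_setOf_ne_zero k M.det.2, hx₀, fun x hx => ?_, fun r hr => ?_⟩
  · have h1 := LinearMap.finrank_le_finrank_of_injective (hAK x hx)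
    have h2 := (ρ x).finrank_range_add_finrank_ker
    have h3 := (ρ x₀).finrank_range_add_finrank_ker
    omega
  have hker : Module.finrank k (LinearMap.ker (ρ x₀)) = Module.finrank k (Fin r → k) := by
    have h3 := (ρ x₀).finrank_range_add_finrank_ker
    rw [Module.finrank_fin_fun]
    omega
  let e := LinearEquiv.ofFinrankEq _ _ hker
  let π : W →ₗ[k] LinearMap.ker (ρ x₀) :=
    (LinearMap.id - q ∘ₗ ρ x₀).codRestrict _ fun w => by simp [hq]
  have hπ : ∀ x w, ρ x w = 0 → (π w : W) = A x w := fun x w hw => (hA' x w hw).symm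
  refine ⟨fun z => (z.1, e (π z.2)), fun z => (z.1, B z.1 (e.symm z.2)), fun X hX => ?_⟩
  have hBker : ∀ x ∈ X, M.det.1 x ≠ 0 → ∀ c : LinearMap.ker (ρ x₀),
      ρ x (B x c) = 0 ∧ π (B x c) = c := by
    intro x hxX hx c
    have hsurj : Function.Surjective (AK x) := by
      refine (LinearMap.injective_iff_surjective_of_finrank_eq_finrank ?_).1 (hAK x hx)
      have h2 := (ρ x).finrank_range_add_finrank_ker
      have h3 := (ρ x₀).finrank_range_add_finrank_ker
      have h4 := hX x hxX
      omega
    obtain ⟨w, rfl⟩ := hsurj c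
    have h5 : B x (AK x w) = w := hBA x hx w
    rw [h5]
    exact ⟨w.2, Subtype.ext (hπ x w w.2)⟩
  constructor
  · intro φ
    refine regularOn_of_mem_polyFun k ?_ _
    exact linear_mem_polyFun k (φ ∘ₗ LinearMap.prodMap LinearMap.id (e.toLinearMap ∘ₗ π))
  · intro φ z hz
    -- `φ ∘ Ψ` is the quotient of `N` by the determinant
    let N : V × (Fin r → k) → k := fun z => M.det.1 z.1 * φ (z.1, 0) +
      ∑ i, (∑ j, (M.adjugate i j).1 z.1 * b.coord j (e.symm z.2)) * φ (0, b i)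
    have hfst : ∀ {p : V → k}, p ∈ polyFun k V →
        (fun z : V × (Fin r → k) => p z.1) ∈ polyFun k (V × (Fin r → k)) := fun hp =>
      comp_linear_mem_polyFun k (LinearMap.fst k V (Fin r → k)) hp
    have hlin : ∀ j, (fun z : V × (Fin r → k) => b.coord j (e.symm z.2)) ∈
        polyFun k (V × (Fin r → k)) := fun j => linear_mem_polyFun k
      (b.coord j ∘ₗ (LinearMap.ker (ρ x₀)).subtype ∘ₗ e.symm.toLinearMap ∘ₗ LinearMap.snd k V _)
    refine ⟨N, ?_, fun z => M.det.1 z.1, hfst M.det.2, hz.1.2, fun y hy hdy => ?_⟩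
    · refine add_mem (mul_mem (hfst M.det.2)
        (hfst (linear_mem_polyFun k (φ ∘ₗ LinearMap.inl k V W)))) ?_
      have : (fun z : V × (Fin r → k) => ∑ i, (∑ j, (M.adjugate i j).1 z.1 *
          b.coord j (e.symm z.2)) * φ (0, b i)) =
          ∑ i, (∑ j, (fun z : V × (Fin r → k) => (M.adjugate i j).1 z.1) *
            (fun z : V × (Fin r → k) => b.coord j (e.symm z.2))) * fun _ => φ (0, b i) := by
        funext z
        simp
      rw [this]
      exact sum_mem fun i _ => mul_mem
        (sum_mem fun j _ => mul_mem (hfst (M.adjugate i j).2) (hlin j))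
        (const_mem_polyFun _)
    · rw [eq_div_iff hdy]
      beta_reduce at hdy ⊢
      have h1 : (y.1, B y.1 (e.symm y.2)) = LinearMap.inl k V W y.1 +
          LinearMap.inr k V W (B y.1 (e.symm y.2)) := by simp
      have h2 : B y.1 (e.symm y.2) = (M.det.1 y.1)⁻¹ • ∑ i, (∑ j, (M.adjugate i j).1 y.1 *
          b.coord j (e.symm y.2)) • b i := by
        simp only [B, LinearMap.smul_apply, Matrix.toLin_apply]
        rfl
      have h3 : φ (LinearMap.inr k V W (B y.1 (e.symm y.2))) = (M.det.1 y.1)⁻¹ *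
          ∑ i, (∑ j, (M.adjugate i j).1 y.1 * b.coord j (e.symm y.2)) * φ (0, b i) := by
        rw [h2]
        simp only [map_smul, map_sum, smul_eq_mul, LinearMap.inr_apply]
      rw [h1, map_add, h3, add_mul, mul_comm, mul_right_comm, inv_mul_cancel₀ hdy, one_mul]
      rfl
  · rintro z ⟨⟨hz, hzX⟩, hzU⟩
    exact ⟨⟨hzX, hzU⟩, trivial⟩
  · rintro z ⟨⟨hzX, hzU⟩, -⟩
    exact ⟨⟨(hBker z.1 hzX hzU _).1, hzX⟩, hzU⟩
  · constructor
    · rintro z ⟨⟨hz, hzX⟩, hzU⟩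
      refine Prod.ext rfl ?_
      change B z.1 (e.symm (e (π z.2)) : W) = z.2
      rw [e.symm_apply_apply, hπ z.1 z.2 hz, hBA z.1 hzU]
    · rintro z ⟨⟨hzX, hzU⟩, -⟩
      refine Prod.ext rfl ?_
      change e (π (B z.1 (e.symm z.2))) = z.2
      rw [(hBker z.1 hzX hzU _).2, e.apply_symm_apply]
  · intro z _
    rfl
  · intro x _
    exact (B x ∘ₗ (LinearMap.ker (ρ x₀)).subtype ∘ₗ e.symm.toLinearMap).isLinear

end Rank

/-! ### Dimensions and irreducible components -/

section Dimension
open Topology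

/-- The integer attached to a Krull dimension, as in `zdim`. -/
def dimToInt (d : WithBot ℕ∞) : ℤ := (d.map fun d : ℕ∞ => (d.toNat : ℤ)).unbotD (-1)

/-- On finite dimensions no information is lost, as `-1` is reserved for the empty set. -/
theorem dimToInt_le_iff {a b : WithBot ℕ∞} (ha : a < ⊤) (hb : b < ⊤) :
    dimToInt a ≤ dimToInt b ↔ a ≤ b := by
  induction a with
  | bot =>
    induction b with
    | bot => simp
    | coe b => simp [dimToInt]
  | coe a =>
    have ha' : a ≠ ⊤ := by rintro rfl; exact lt_irrefl _ ha
    lift a to ℕ using ha'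
    induction b with
    | bot => simp [dimToInt]; omega
    | coe b =>
      have hb' : b ≠ ⊤ := by rintro rfl; exact lt_irrefl _ hb
      lift b to ℕ using hb'
      simp [dimToInt]

theorem dimToInt_add {a : WithBot ℕ∞} (ha : a < ⊤) (ha' : a ≠ ⊥) (r : ℕ) :
    dimToInt (a + r) = dimToInt a + r := by
  induction a with
  | bot => exact absurd rfl ha'
  | coe a =>
    have ha' : a ≠ ⊤ := by rintro rfl; exact lt_irrefl _ ha
    lift a to ℕ using ha'
    have : ((a : ℕ∞) : WithBot ℕ∞) + (r : WithBot ℕ∞) = (((a + r : ℕ) : ℕ∞) : WithBot ℕ∞) := by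
      push_cast; rfl
    rw [this]
    change ((a + r : ℕ) : ℤ) = (a : ℤ) + r
    exact Nat.cast_add a r

variable (k : Type*) [Field k] {V : Type*} [AddCommGroup V] [Module k V]
variable {W : Type*} [AddCommGroup W] [Module k W]

/-- The Krull dimension of `S` in the subspace topology of the Zariski topology. -/
noncomputable def kdim (S : Set V) : WithBot ℕ∞ :=
  @topologicalKrullDim S (@instTopologicalSpaceSubtype _ _ (zariski k V))

theorem zdim_eq_dimToInt (S : Set V) : zdim k S = dimToInt (kdim k S) := rfl

theorem kdim_lt_top [FiniteDimensional k V] (S : Set V) : kdim k S < ⊤ := krullDim_lt_top k S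

variable {k} in
theorem zdim_le_iff [FiniteDimensional k V] [FiniteDimensional k W] {S : Set V} {T : Set W} :
    zdim k S ≤ zdim k T ↔ kdim k S ≤ kdim k T :=
  dimToInt_le_iff (kdim_lt_top k S) (kdim_lt_top k T)

theorem zdim_mono [FiniteDimensional k V] {S T : Set V} (h : S ⊆ T) : zdim k S ≤ zdim k T := by
  let _ : TopologicalSpace V := zariski k V
  exact zdim_le_iff.2 (topologicalKrullDim_mono h)

theorem isLocallyClosed_zclosure (S : Set V) : @IsLocallyClosed V (zariski k V) (zclosure k S) := by
  let _ : TopologicalSpace V := zariski k V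
  exact (isClosed_closure (s := S)).isLocallyClosed

theorem ZIrreducible.zclosure {S : Set V} (hS : ZIrreducible k S) :
    ZIrreducible k (zclosure k S) := by
  rw [zIrreducible_iff_isPrime] at hS ⊢
  rwa [vanishing_zclosure]

theorem kdim_eq [IsAlgClosed k] [FiniteDimensional k V] {S : Set V} (hS : ZIrreducible k S)
    (hloc : @IsLocallyClosed V (zariski k V) S) : kdim k S = ringKrullDim (coordRing k S) :=
  topologicalKrullDim_eq_ringKrullDim k hS hloc

/-- Irreducible locally closed sets with the same closure have the same dimension. -/
theorem kdim_eq_of_vanishing_eq [IsAlgClosed k] [FiniteDimensional k V] {S T : Set V}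
    (hS : ZIrreducible k S) (hSl : @IsLocallyClosed V (zariski k V) S)
    (hTl : @IsLocallyClosed V (zariski k V) T) (h : vanishing k S = vanishing k T) :
    kdim k S = kdim k T := by
  have hT : ZIrreducible k T := by
    rw [zIrreducible_iff_isPrime] at hS ⊢
    rwa [← h]
  have key : ∀ I J : Ideal (polyFun k V), I = J →
      ringKrullDim (polyFun k V ⧸ I) = ringKrullDim (polyFun k V ⧸ J) := by
    rintro I _ rfl
    rfl
  rw [kdim_eq k hS hSl, kdim_eq k hT hTl]
  exact key _ _ h

theorem zdim_zclosure [IsAlgClosed k] [FiniteDimensional k V] {S : Set V} (hS : ZIrreducible k S)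
    (hSl : @IsLocallyClosed V (zariski k V) S) : zdim k (zclosure k S) = zdim k S :=
  congrArg dimToInt (kdim_eq_of_vanishing_eq k (hS.zclosure k) (isLocallyClosed_zclosure k S) hSl
    (vanishing_zclosure k S))

theorem kdim_prod_univ [IsAlgClosed k] [FiniteDimensional k V] {Y : Set V} (hY : ZIrreducible k Y)
    (hYl : @IsLocallyClosed V (zariski k V) Y) (r : ℕ) :
    kdim k (Y ×ˢ Set.univ : Set (V × (Fin r → k))) = kdim k Y + r := by
  have : Infinite k := IsAlgClosed.instInfinite
  have hl : @IsLocallyClosed (V × (Fin r → k)) (zariski k _) (Y ×ˢ Set.univ) := by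
    let _ : TopologicalSpace V := zariski k V
    let _ : TopologicalSpace (V × (Fin r → k)) := zariski k _
    rw [Set.prod_univ]
    exact hYl.preimage (continuous_zariski_linear (LinearMap.fst k V (Fin r → k)))
  rw [kdim_eq k (zIrreducible_prod_univ k hY r) hl, kdim_eq k hY hYl, ringKrullDim_coordRing_prod]

/-- The components of `S` are its maximal irreducible subsets, taken in the ambient space. -/
theorem mem_Irr_iff {S X : Set V} :
    X ∈ Irr k S ↔ Maximal (fun T => T ⊆ S ∧ ZIrreducible k T) X := by
  let _ : TopologicalSpace V := zariski k V
  constructor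
  · rintro ⟨Y, hY, rfl⟩
    refine ⟨⟨by simp, isIrreducible_image_val_iff.2 hY.1⟩, ?_⟩
    rintro T ⟨hTS, hT⟩ hYT
    have hT' : T = (↑) '' ((↑) ⁻¹' T : Set S) := by
      rw [Subtype.image_preimage_coe, Set.inter_eq_right.2 hTS]
    have h1 : IsIrreducible ((↑) ⁻¹' T : Set S) := by
      rw [← isIrreducible_image_val_iff, ← hT']
      exact hT
    rw [hT']
    exact Set.image_mono (hY.2 h1 (Set.image_subset_iff.1 hYT))
  · rintro ⟨⟨hXS, hX⟩, hmax⟩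
    have hX' : (↑) '' ((↑) ⁻¹' X : Set S) = X := by
      rw [Subtype.image_preimage_coe, Set.inter_eq_right.2 hXS]
    refine ⟨(↑) ⁻¹' X, ⟨?_, ?_⟩, hX'⟩
    · rw [← isIrreducible_image_val_iff, hX']
      exact hX
    · intro T hT hXT
      refine Set.image_subset_iff.1 (hmax ⟨by simp, isIrreducible_image_val_iff.2 hT⟩ ?_)
      rw [← hX']
      exact Set.image_mono hXT

theorem exists_mem_Irr_zdim_eq [FiniteDimensional k V] {S : Set V} (hS : S.Nonempty) :
    ∃ X ∈ Irr k S, zdim k X = zdim k S := by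
  let _ : TopologicalSpace V := zariski k V
  obtain ⟨Y, hY, hdim⟩ := exists_maximal_irreducible_topologicalKrullDim_eq hS (kdim_lt_top k S)
  exact ⟨Y, (mem_Irr_iff k).2 hY, congrArg dimToInt hdim⟩

theorem exists_mem_Irr_of_zIrreducible {S T : Set V} (hT : ZIrreducible k T) (hTS : T ⊆ S) :
    ∃ X ∈ Irr k S, T ⊆ X := by
  let _ : TopologicalSpace V := zariski k V
  have hT' : (↑) '' ((↑) ⁻¹' T : Set S) = T := by
    rw [Subtype.image_preimage_coe, Set.inter_eq_right.2 hTS]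
  obtain ⟨Y, hY, hTY, hmax⟩ := exists_preirreducible ((↑) ⁻¹' T : Set S)
    (isIrreducible_image_val_iff.1 (hT'.symm ▸ hT)).2
  refine ⟨(↑) '' Y, ⟨Y, ⟨⟨?_, hY⟩, fun Z hZ hYZ => (hmax Z hZ.2 hYZ).le⟩, rfl⟩, ?_⟩
  · obtain ⟨t, ht⟩ := hT.1
    exact ⟨⟨t, hTS ht⟩, hTY ht⟩
  · rw [← hT']
    exact Set.image_mono hTY

theorem zclosure_inter_eq_of_mem_Irr {S X : Set V} (hX : X ∈ Irr k S) : zclosure k X ∩ S = X := by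
  rw [mem_Irr_iff] at hX
  have hsub : X ⊆ zclosure k X ∩ S := fun x hx => ⟨subset_zclosure k X hx, hX.1.1 hx⟩
  refine subset_antisymm (hX.2 ⟨Set.inter_subset_right, ?_⟩ hsub) hsub
  have h := hX.1.2
  rw [zIrreducible_iff_isPrime] at h ⊢
  have : vanishing k (zclosure k X ∩ S) = vanishing k X := by
    refine le_antisymm (vanishing_anti k hsub) ?_
    conv_lhs => rw [← vanishing_zclosure]
    exact vanishing_anti k Set.inter_subset_left
  rwa [this]

theorem isLocallyClosed_of_mem_Irr {S X : Set V} (hS : @IsLocallyClosed V (zariski k V) S)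
    (hX : X ∈ Irr k S) : @IsLocallyClosed V (zariski k V) X := by
  let _ : TopologicalSpace V := zariski k V
  rw [← zclosure_inter_eq_of_mem_Irr k hX]
  exact (isLocallyClosed_zclosure k X).inter hS

theorem isClosed_of_mem_Irr {S X : Set V} (hS : IsClosed[zariski k V] S) (hX : X ∈ Irr k S) :
    IsClosed[zariski k V] X := by
  let _ : TopologicalSpace V := zariski k V
  rw [← zclosure_inter_eq_of_mem_Irr k hX]
  exact isClosed_closure.inter hS

theorem eq_of_zdim_le [FiniteDimensional k V] {C D : Set V} (hC : IsClosed[zariski k V] C)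
    (hD : IsClosed[zariski k V] D) (hCi : ZIrreducible k C) (hDi : ZIrreducible k D) (hCD : C ⊆ D)
    (h : zdim k D ≤ zdim k C) : C = D := by
  let _ : TopologicalSpace V := zariski k V
  exact eq_of_topologicalKrullDim_le hC hD hDi hCi hCD (kdim_lt_top k D) (zdim_le_iff.1 h)

theorem kdim_ne_bot {S : Set V} (hS : S.Nonempty) : kdim k S ≠ ⊥ := by
  let _ : TopologicalSpace V := zariski k V
  exact topologicalKrullDim_ne_bot hS

end Dimension

/-! ### Rank strata of linear families -/

section KernelFamily
open Topology

variable {k : Type*} [Field k] {V : Type*} [AddCommGroup V] [Module k V]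
variable {W : Type*} [AddCommGroup W] [Module k W] [FiniteDimensional k W]
variable {W' : Type*} [AddCommGroup W'] [Module k W'] (ρ : V →ₗ[k] W →ₗ[k] W') {X : Set V} {n : ℕ}

theorem isOpen_setOf_le_finrank_range (n : ℕ) :
    IsOpen[zariski k V] {x | n ≤ Module.finrank k (LinearMap.range (ρ x))} := by
  let _ : TopologicalSpace V := zariski k V
  refine isOpen_iff_forall_mem_open.2 fun x hx => ?_
  obtain ⟨U, hU, hxU, h, -⟩ := exists_isTrivialisation_kernelFamily ρ x
  exact ⟨U, fun y hy => le_trans hx (h y hy), hU, hxU⟩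

theorem isClosed_setOf_finrank_range_le (n : ℕ) :
    IsClosed[zariski k V] {x | Module.finrank k (LinearMap.range (ρ x)) ≤ n} := by
  let _ : TopologicalSpace V := zariski k V
  have : {x | Module.finrank k (LinearMap.range (ρ x)) ≤ n} =
      {x | n + 1 ≤ Module.finrank k (LinearMap.range (ρ x))}ᶜ := by
    ext x; simp
  rw [this]
  exact (isOpen_setOf_le_finrank_range ρ (n + 1)).isClosed_compl

theorem isLocallyClosed_setOf_finrank_range_eq (n : ℕ) :
    @IsLocallyClosed V (zariski k V) {x | Module.finrank k (LinearMap.range (ρ x)) = n} := by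
  let _ : TopologicalSpace V := zariski k V
  have : {x | Module.finrank k (LinearMap.range (ρ x)) = n} =
      {x | n ≤ Module.finrank k (LinearMap.range (ρ x))} ∩
      {x | Module.finrank k (LinearMap.range (ρ x)) ≤ n} := by
    ext x; simp [le_antisymm_iff, and_comm]
  rw [this]
  exact ⟨_, _, isOpen_setOf_le_finrank_range ρ n, isClosed_setOf_finrank_range_le ρ n, rfl⟩

theorem isClosed_kernelFamily_univ : IsClosed[zariski k (V × W)] {z : V × W | ρ z.1 z.2 = 0} := by
  let _ : TopologicalSpace (V × W) := zariski k (V × W)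
  let b := Module.finBasis k W
  have : {z : V × W | ρ z.1 z.2 = 0} = ⋂ φ : Module.Dual k W', {z | φ (ρ z.1 z.2) = 0} := by
    ext z
    simp only [Set.mem_iInter, Set.mem_ofPred_eq]
    exact ⟨fun h φ => by rw [h, map_zero], fun h => (Module.forall_dual_apply_eq_zero_iff k _).1 h⟩
  rw [this]
  refine isClosed_iInter fun φ => isClosed_setOf_eq_zero k (p := fun z : V × W => φ (ρ z.1 z.2)) ?_
  have h : (fun z : V × W => φ (ρ z.1 z.2)) = ∑ i,
      (((φ ∘ₗ ρ.flip (b i) ∘ₗ LinearMap.fst k V W : Module.Dual k (V × W)) : V × W → k) *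
        ((b.coord i ∘ₗ LinearMap.snd k V W : Module.Dual k (V × W)) : V × W → k)) := by
    funext z
    conv_lhs => rw [← b.sum_repr z.2]
    simp only [map_sum, map_smul, smul_eq_mul, Finset.sum_apply, Pi.mul_apply]
    exact Finset.sum_congr rfl fun i _ => mul_comm _ _
  rw [h]
  exact sum_mem fun i _ => mul_mem (linear_mem_polyFun k _) (linear_mem_polyFun k _)

theorem isLocallyClosed_kernelFamily (hX : @IsLocallyClosed V (zariski k V) X) :
    @IsLocallyClosed (V × W) (zariski k (V × W)) (kernelFamily ρ X) := by
  let _ : TopologicalSpace V := zariski k V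
  let _ : TopologicalSpace (V × W) := zariski k (V × W)
  exact (isClosed_kernelFamily_univ ρ).isLocallyClosed.inter
    (hX.preimage (continuous_zariski_linear (LinearMap.fst k V W)))

variable {ρ}

theorem isVectorBundle_kernelFamily {r : ℕ} (hX : @IsLocallyClosed V (zariski k V) X)
    (hn : ∀ x ∈ X, Module.finrank k (LinearMap.range (ρ x)) = n)
    (hr : r + n = Module.finrank k W) : IsVectorBundle k (kernelFamily ρ X) X r where
  base_locallyClosed := hX
  total_locallyClosed := isLocallyClosed_kernelFamily ρ hX
  proj_mem := fun _ hz => hz.2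
  fibre_subspace := fun x hx => ⟨LinearMap.ker (ρ x), by ext w; simp [kernelFamily, hx]⟩
  locally_trivial := fun x hx => by
    obtain ⟨U, hU, hxU, -, h⟩ := exists_isTrivialisation_kernelFamily ρ x
    obtain ⟨Φ, Ψ, hΦ⟩ := h r (by rw [hn x hx, hr])
    exact ⟨U, hU, hxU, Φ, Ψ, hΦ X fun y hy => by rw [hn y hy, hn x hx]⟩

end KernelFamily

/-! ### Topology and dimension of vector bundles -/

section VectorBundle
open Topology

variable {k : Type*} [Field k] {V : Type*} [AddCommGroup V] [Module k V]
variable {W : Type*} [AddCommGroup W] [Module k W] {X : Set V} {E : Set (V × W)} {r : ℕ}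

/-- The projection of a vector bundle is open, because it has a continuous local section through
every point of its total space. -/
theorem IsVectorBundle.exists_isOpen_subset_image (h : IsVectorBundle k E X r)
    {O : Set (V × W)} (hO : IsOpen[zariski k (V × W)] O)
    {z : V × W} (hz : z ∈ E) (hzO : z ∈ O) :
    ∃ N, IsOpen[zariski k V] N ∧ z.1 ∈ N ∧ ∀ x ∈ N ∩ X, ∃ z' ∈ E ∩ O, z'.1 = x := by
  let _ : TopologicalSpace V := zariski k V
  let _ : TopologicalSpace (V × W) := zariski k (V × W)
  let _ : TopologicalSpace (V × (Fin r → k)) := zariski k (V × (Fin r → k))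
  obtain ⟨U, hU, hzU, Φ, Ψ, hΦ⟩ := h.locally_trivial z.1 (h.proj_mem z hz)
  have hs : ContinuousOn (fun x => Ψ (x, (Φ z).2)) (X ∩ U) :=
    (hΦ.morphism_inv.continuousOn).comp
      (continuous_zariski_prodMk (fun φ => linear_mem_polyFun k φ)
        fun φ => const_mem_polyFun (φ (Φ z).2)).continuousOn
      fun x hx => ⟨hx, trivial⟩
  have hzs : Ψ (z.1, (Φ z).2) = z := by
    rw [← hΦ.fst_eq z ⟨hz, hzU⟩]
    exact hΦ.invOn.1 ⟨hz, hzU⟩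
  obtain ⟨N, hN, hzN, hNO⟩ := mem_nhdsWithin.1
    (hs z.1 ⟨h.proj_mem z hz, hzU⟩ (hO.mem_nhds (hzs.symm ▸ hzO : Ψ (z.1, (Φ z).2) ∈ O)))
  refine ⟨N ∩ U, hN.inter hU, ⟨hzN, hzU⟩, ?_⟩
  rintro x ⟨⟨hxN, hxU⟩, hxX⟩
  have hmem : (x, (Φ z).2) ∈ (X ∩ U) ×ˢ (Set.univ : Set (Fin r → k)) := ⟨⟨hxX, hxU⟩, trivial⟩
  refine ⟨Ψ (x, (Φ z).2), ⟨(hΦ.mapsTo_inv hmem).1, hNO ⟨hxN, hxX, hxU⟩⟩, ?_⟩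
  rw [← hΦ.fst_eq _ (hΦ.mapsTo_inv hmem), hΦ.invOn.2 hmem]

/-- The projection of a vector bundle to its base. -/
def IsVectorBundle.proj (h : IsVectorBundle k E X r) : E → X :=
  fun z => ⟨z.1.1, h.proj_mem z.1 z.2⟩

theorem IsVectorBundle.zOpenMap_proj (h : IsVectorBundle k E X r) :
    ZOpenMap k h.proj := by
  let _ : TopologicalSpace V := zariski k V
  let _ : TopologicalSpace (V × W) := zariski k (V × W)
  rintro _ ⟨O, hO, rfl⟩
  refine isOpen_iff_forall_mem_open.2 ?_
  rintro _ ⟨z, hz, rfl⟩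
  obtain ⟨N, hN, hzN, hNO⟩ := h.exists_isOpen_subset_image hO z.2 hz
  refine ⟨Subtype.val ⁻¹' N, fun x hx => ?_, hN.preimage continuous_subtype_val, hzN⟩
  obtain ⟨z', ⟨hz'E, hz'O⟩, hz'⟩ := hNO x ⟨hx, x.2⟩
  exact ⟨⟨z', hz'E⟩, hz'O, Subtype.ext hz'⟩

theorem zIrreducible_fibre [Infinite k] [FiniteDimensional k W] (x : V) (F : Submodule k W) :
    ZIrreducible k ({x} ×ˢ (F : Set W)) := by
  let b := Module.finBasis k F
  have h0 : ZIrreducible k ({x} : Set V) := @isIrreducible_singleton V (zariski k V) x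
  have h1 := zIrreducible_prod_univ k h0 (Module.finrank k F)
  let f := LinearMap.prodMap (LinearMap.id : V →ₗ[k] V) (F.subtype ∘ₗ b.equivFun.symm.toLinearMap)
  have h2 : f '' ({x} ×ˢ Set.univ) = {x} ×ˢ (F : Set W) := by
    ext ⟨y, w⟩
    constructor
    · rintro ⟨⟨y', c⟩, ⟨hy, -⟩, h⟩
      have h3 := congrArg Prod.fst h
      have h4 := congrArg Prod.snd h
      exact ⟨h3.symm.trans hy, by rw [← h4]; exact (b.equivFun.symm c).2⟩
    · rintro ⟨hy, hw⟩
      refine ⟨(y, b.equivFun ⟨w, hw⟩), ⟨hy, trivial⟩, Prod.ext rfl ?_⟩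
      change (b.equivFun.symm (b.equivFun ⟨w, hw⟩) : W) = w
      rw [LinearEquiv.symm_apply_apply]
  rw [← h2]
  let _ : TopologicalSpace (V × W) := zariski k _
  let _ : TopologicalSpace (V × (Fin (Module.finrank k F) → k)) := zariski k _
  exact IsIrreducible.image h1 f (continuous_zariski_linear f).continuousOn

/-- The projection of a bundle is an open surjection whose fibres are vector spaces, hence
irreducible. -/
theorem IsVectorBundle.zIrreducible [Infinite k] [FiniteDimensional k W]
    (h : IsVectorBundle k E X r) (hX : ZIrreducible k X) : ZIrreducible k E := by
  let _ : TopologicalSpace V := zariski k V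
  let _ : TopologicalSpace (V × W) := zariski k (V × W)
  have hE : E = (↑) '' (h.proj ⁻¹' Set.univ) := by simp
  have hX' : IsIrreducible (Set.univ : Set X) := by
    rw [← isIrreducible_image_val_iff, Set.image_univ, Subtype.range_coe]
    exact hX
  rw [hE]
  refine isIrreducible_image_val_iff.2
    (hX'.preimage_of_isPreirreducible_fiber _ h.zOpenMap_proj (fun x => ?_) ?_)
  · obtain ⟨F, hF⟩ := h.fibre_subspace x.1 x.2
    refine (isIrreducible_image_val_iff.1 ?_).2
    convert (show IsIrreducible _ from zIrreducible_fibre (k := k) x.1 F)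
    rw [hF]
    ext ⟨y, w⟩
    constructor
    · rintro ⟨z, hz, hzy⟩
      have h1 : z.1.1 = x.1 := congrArg Subtype.val hz
      have h2 : y = x.1 := by rw [← h1, hzy]
      refine ⟨h2, ?_⟩
      change (x.1, w) ∈ E
      rw [← h2, ← hzy]
      exact z.2
    · rintro ⟨hy, hw⟩
      have hy' : y = x.1 := hy
      subst hy'
      exact ⟨⟨(x.1, w), hw⟩, Subtype.ext rfl, rfl⟩
  · obtain ⟨x, hx⟩ := hX.1
    obtain ⟨F, hF⟩ := h.fibre_subspace x hx
    have h0 : (x, (0 : W)) ∈ E := by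
      have : (0 : W) ∈ (F : Set W) := F.zero_mem
      rwa [hF] at this
    exact ⟨⟨x, hx⟩, trivial, ⟨(x, 0), h0⟩, rfl⟩

/-- The total space of a bundle of rank `r` over an irreducible base `X` has dimension `dim X + r`:
dimensions can be computed on an open subset over which the bundle is trivial. -/
theorem IsVectorBundle.zdim_zclosure [IsAlgClosed k] [FiniteDimensional k V]
    [FiniteDimensional k W] (h : IsVectorBundle k E X r) (hX : ZIrreducible k X) :
    zdim k (zclosure k E) = zdim k X + r := by
  have : Infinite k := IsAlgClosed.instInfinite
  have hE := h.zIrreducible hX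
  obtain ⟨x, hx⟩ := hX.1
  obtain ⟨U, hU, hxU, Φ, Ψ, hΦ⟩ := h.locally_trivial x hx
  let _ : TopologicalSpace V := zariski k V
  let _ : TopologicalSpace (V × W) := zariski k (V × W)
  let _ : TopologicalSpace (V × (Fin r → k)) := zariski k (V × (Fin r → k))
  have hU' : IsOpen (Prod.fst ⁻¹' U : Set (V × W)) :=
    hU.preimage (continuous_zariski_linear (LinearMap.fst k V W))
  have hne : (E ∩ Prod.fst ⁻¹' U).Nonempty :=
    ⟨Ψ (x, 0), hΦ.mapsTo_inv (x := (x, 0)) ⟨⟨hx, hxU⟩, trivial⟩⟩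
  have e1 : vanishing k (X ∩ U) = vanishing k X := vanishing_inter_isOpen hX hU ⟨x, hx, hxU⟩
  have e2 : vanishing k (E ∩ Prod.fst ⁻¹' U) = vanishing k E := vanishing_inter_isOpen hE hU' hne
  have l1 : IsLocallyClosed (X ∩ U) := h.base_locallyClosed.inter hU.isLocallyClosed
  have l2 : IsLocallyClosed (E ∩ Prod.fst ⁻¹' U) := h.total_locallyClosed.inter hU'.isLocallyClosed
  have i1 : ZIrreducible k (X ∩ U) := by
    rw [zIrreducible_iff_isPrime] at hX ⊢
    rwa [e1]
  have d1 : kdim k (zclosure k E) = kdim k (E ∩ Prod.fst ⁻¹' U) :=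
    kdim_eq_of_vanishing_eq k (hE.zclosure k) (isLocallyClosed_zclosure k E) l2
      (by rw [vanishing_zclosure, e2])
  have d2 : kdim k (E ∩ Prod.fst ⁻¹' U) = kdim k ((X ∩ U) ×ˢ (Set.univ : Set (Fin r → k))) :=
    topologicalKrullDim_eq_of_invOn hΦ.morphism_to.continuousOn hΦ.morphism_inv.continuousOn
      hΦ.mapsTo hΦ.mapsTo_inv hΦ.invOn
  have d3 : kdim k (X ∩ U) = kdim k X := kdim_eq_of_vanishing_eq k i1 l1 h.base_locallyClosed e1
  rw [zdim_eq_dimToInt, d1, d2, kdim_prod_univ k i1 l1, d3,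
    dimToInt_add (kdim_lt_top k X) (kdim_ne_bot k hX.1), zdim_eq_dimToInt]

end VectorBundle

/-! ### The commuting variety -/

section Lie
open Topology

/-- The adjoint representation as a linear family of linear maps. -/
def adLinear (k g : Type*) [Field k] [LieRing g] [LieAlgebra k g] : g →ₗ[k] g →ₗ[k] g :=
  (LieAlgebra.ad k g : g →ₗ[k] Module.End k g)

variable {k : Type*} [Field k] {g : Type*} [LieRing g] [LieAlgebra k g]

/-- A component `C` of the commuting variety contains `(y, y)` whenever it contains `(x, y)`: the
maps `(x, y) ↦ ((1 - c) x + c y, y)` preserve the commuting variety, the union of the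
images of `C` under them is irreducible, and `c = 0` gives back `C`. -/
theorem snd_snd_mem_of_mem_Irr [IsAlgClosed k] {C : Set (g × g)}
    (hC : C ∈ Irr k (commutingVariety g)) {z : g × g} (hz : z ∈ C) : (z.2, z.2) ∈ C := by
  have : Infinite k := IsAlgClosed.instInfinite
  have hC' := (mem_Irr_iff k).1 hC
  let F : (g × g) × (Fin 1 → k) → g × g := fun w =>
    ((1 - w.2 0) • w.1.1 + w.2 0 • w.1.2, w.1.2)
  have hF : Continuous[zariski k _, zariski k _] F := by
    refine continuous_zariski_prodMk (fun φ => ?_) fun φ => linear_mem_polyFun k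
      (φ ∘ₗ LinearMap.snd k g g ∘ₗ LinearMap.fst k (g × g) (Fin 1 → k))
    let c : Module.Dual k ((g × g) × (Fin 1 → k)) := LinearMap.proj 0 ∘ₗ LinearMap.snd k _ _
    let φ₁ : Module.Dual k ((g × g) × (Fin 1 → k)) :=
      φ ∘ₗ LinearMap.fst k g g ∘ₗ LinearMap.fst k (g × g) (Fin 1 → k)
    let φ₂ : Module.Dual k ((g × g) × (Fin 1 → k)) :=
      φ ∘ₗ LinearMap.snd k g g ∘ₗ LinearMap.fst k (g × g) (Fin 1 → k)
    have h : (fun w : (g × g) × (Fin 1 → k) => φ ((1 - w.2 0) • w.1.1 + w.2 0 • w.1.2)) =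
        (1 - (c : _ → k)) * (φ₁ : _ → k) + (c : _ → k) * (φ₂ : _ → k) := by
      funext w
      simp [c, φ₁, φ₂]
    rw [h]
    exact add_mem (mul_mem (sub_mem (one_mem _) (linear_mem_polyFun k c)) (linear_mem_polyFun k φ₁))
      (mul_mem (linear_mem_polyFun k c) (linear_mem_polyFun k φ₂))
  let T : Set (g × g) := F '' (C ×ˢ Set.univ)
  have hT : ZIrreducible k T := by
    let _ : TopologicalSpace (g × g) := zariski k _
    let _ : TopologicalSpace ((g × g) × (Fin 1 → k)) := zariski k _
    exact IsIrreducible.image (zIrreducible_prod_univ k hC'.1.2 1) F hF.continuousOn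
  have hTC : T ⊆ commutingVariety g := by
    rintro _ ⟨⟨w, c⟩, ⟨hw, -⟩, rfl⟩
    have h : ⁅w.1, w.2⁆ = 0 := hC'.1.1 hw
    change ⁅(1 - c 0) • w.1 + c 0 • w.2, w.2⁆ = 0
    simp [h]
  refine hC'.2 ⟨hTC, hT⟩ (fun w hw => ⟨(w, 0), ⟨hw, trivial⟩, ?_⟩) ⟨(z, 1), ⟨hz, trivial⟩, ?_⟩
  · simp [F]
  · simp [F]

variable (k) in
theorem fst_mem_zclosure {X : Set g} {z : g × g} (hz : z ∈ zclosure k (fibration X)) :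
    z.1 ∈ zclosure k X := by
  let _ : TopologicalSpace g := zariski k g
  let _ : TopologicalSpace (g × g) := zariski k (g × g)
  exact closure_minimal (s := fibration X) (fun z hz => subset_zclosure k X hz.2)
    ((isClosed_closure (s := X)).preimage (continuous_zariski_linear (LinearMap.fst k g g))) hz

theorem subset_fst_image {X : Set g} {C : Set (g × g)} (h : fibration X ⊆ C) :
    X ⊆ Prod.fst '' C :=
  fun x hx => ⟨(x, 0), h ⟨lie_zero x, hx⟩, rfl⟩

variable [FiniteDimensional k g]

variable (k g) in
theorem isLocallyClosed_stratum (n : ℕ) : @IsLocallyClosed g (zariski k g) (stratum k g n) :=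
  isLocallyClosed_setOf_finrank_range_eq (adLinear k g) n

variable (k g) in
theorem isClosed_commutingVariety : IsClosed[zariski k (g × g)] (commutingVariety g) :=
  isClosed_kernelFamily_univ (adLinear k g)

theorem isVectorBundle_fibration {n : ℕ} {X : Set g} (hX : @IsLocallyClosed g (zariski k g) X)
    (hXn : X ⊆ stratum k g n) {r : ℕ} (hr : r + n = Module.finrank k g) :
    IsVectorBundle k (fibration X) X r :=
  isVectorBundle_kernelFamily (ρ := adLinear k g) hX hXn hr

theorem le_finrank_of_mem_stratum {n : ℕ} {x : g} (hx : x ∈ stratum k g n) :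
    n ≤ Module.finrank k g :=
  hx ▸ Submodule.finrank_le (LinearMap.range (LieAlgebra.ad k g x : g →ₗ[k] g))

variable (k) in
theorem zclosure_fibration_subset (X : Set g) :
    zclosure k (fibration X) ⊆ commutingVariety g := by
  let _ : TopologicalSpace (g × g) := zariski k (g × g)
  exact closure_minimal (fun z hz => hz.1) (isClosed_commutingVariety k g)

variable (k g) in
theorem zclosure_stratum_subset (n : ℕ) :
    zclosure k (stratum k g n) ⊆ ⋃ m ≤ n, stratum k g m := by
  let _ : TopologicalSpace g := zariski k g
  intro x hx
  have h1 : x ∈ {x | Module.finrank k (LinearMap.range (LieAlgebra.ad k g x : g →ₗ[k] g)) ≤ n} :=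
    closure_minimal (fun x hx => le_of_eq hx)
      (isClosed_setOf_finrank_range_le (adLinear k g) n) hx
  exact Set.mem_biUnion (show _ ∈ {m | m ≤ n} from h1) rfl

variable [IsAlgClosed k]

theorem zIrreducible_zclosure_fibration {n : ℕ} {X : Set g} (hX : X ∈ Irr k (stratum k g n)) :
    ZIrreducible k (zclosure k (fibration X)) := by
  have hX' := ((mem_Irr_iff k).1 hX).1
  obtain ⟨x, hx⟩ := hX'.2.1
  obtain ⟨r, hr⟩ := Nat.exists_eq_add_of_le' (le_finrank_of_mem_stratum (hX'.1 hx))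
  have : Infinite k := IsAlgClosed.instInfinite
  exact ((isVectorBundle_fibration (isLocallyClosed_of_mem_Irr k (isLocallyClosed_stratum k g n) hX)
    hX'.1 hr.symm).zIrreducible hX'.2).zclosure k

theorem zdim_zclosure_fibration {n : ℕ} {X : Set g} (hX : X ∈ Irr k (stratum k g n)) :
    zdim k (zclosure k (fibration X)) = zdim k X + Module.finrank k g - n := by
  have hX' := ((mem_Irr_iff k).1 hX).1
  obtain ⟨x, hx⟩ := hX'.2.1
  obtain ⟨r, hr⟩ := Nat.exists_eq_add_of_le' (le_finrank_of_mem_stratum (hX'.1 hx))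
  rw [(isVectorBundle_fibration (isLocallyClosed_of_mem_Irr k (isLocallyClosed_stratum k g n) hX)
    hX'.1 hr.symm).zdim_zclosure hX'.2, hr]
  push_cast
  ring

/-- Every component `C` of the commuting variety is the closure of the preimage of a component of
the stratum of generic rank on `pr₁(C)`. -/
theorem exists_eq_zclosure_fibration {C : Set (g × g)} (hC : C ∈ Irr k (commutingVariety g)) :
    ∃ n, IsGreatest {n : ℕ | (stratum k g n ∩ Prod.fst '' C).Nonempty} n ∧
      ∃ X ∈ Irr k (stratum k g n), C = zclosure k (fibration X) := by
  let _ : TopologicalSpace g := zariski k g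
  let _ : TopologicalSpace (g × g) := zariski k (g × g)
  have hC' := (mem_Irr_iff k).1 hC
  let S : Set ℕ := {n : ℕ | (stratum k g n ∩ Prod.fst '' C).Nonempty}
  have hne : S.Nonempty := by
    obtain ⟨z, hz⟩ := hC'.1.2.1
    exact ⟨_, z.1, rfl, z, hz, rfl⟩
  have hbdd : BddAbove S := ⟨Module.finrank k g, fun n hn => by
    obtain ⟨x, hx, -⟩ := hn
    exact le_finrank_of_mem_stratum hx⟩
  have hn : IsGreatest S (sSup S) := ⟨Nat.sSup_mem hne hbdd, fun m hm => le_csSup hbdd hm⟩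
  generalize sSup S = n at hn
  refine ⟨n, hn, ?_⟩
  have hfst := continuous_zariski_linear (LinearMap.fst k g g)
  let U : Set (g × g) :=
    Prod.fst ⁻¹' {x | n ≤ Module.finrank k (LinearMap.range (LieAlgebra.ad k g x : g →ₗ[k] g))}
  have hU : IsOpen U :=
    (isOpen_setOf_le_finrank_range (adLinear k g) n).preimage hfst
  have hCU : (C ∩ U).Nonempty := by
    obtain ⟨x, hx, z, hz, rfl⟩ := hn.1
    exact ⟨z, hz, (le_of_eq (Eq.symm hx) : n ≤ _)⟩
  have hvan := vanishing_inter_isOpen hC'.1.2 hU hCU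
  have hirr : ZIrreducible k (C ∩ U) := by
    have := hC'.1.2
    rw [zIrreducible_iff_isPrime] at this ⊢
    rwa [hvan]
  have hstr : Prod.fst '' (C ∩ U) ⊆ stratum k g n := by
    rintro _ ⟨z, ⟨hz, hzU⟩, rfl⟩
    exact le_antisymm (hn.2 ⟨z.1, rfl, z, hz, rfl⟩) hzU
  obtain ⟨X, hX, hCX⟩ := exists_mem_Irr_of_zIrreducible k
    (show ZIrreducible k (Prod.fst '' (C ∩ U)) from
      IsIrreducible.image hirr _ hfst.continuousOn) hstr
  refine ⟨X, hX, ?_⟩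
  have hsub : C ⊆ zclosure k (fibration X) := by
    refine (subset_zclosure k C).trans ?_
    rw [← zclosure_eq_of_vanishing_eq k hvan]
    exact closure_mono fun z hz => ⟨hC'.1.1 hz.1, hCX ⟨z, hz, rfl⟩⟩
  exact subset_antisymm hsub
    (hC'.2 ⟨zclosure_fibration_subset k X, zIrreducible_zclosure_fibration hX⟩ hsub)

variable (k g) in
/-- The maximum of the dimensions `dim X + dim g - n` over the components `X` of the strata is
attained, and every component of the commuting variety is of this form. -/
theorem zdim_commutingVariety :
    zdim k (commutingVariety g) = Module.finrank k g + modality k g := by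
  have hmod := isGreatest_modality k g
  apply le_antisymm
  · obtain ⟨C, hC, hdim⟩ := exists_mem_Irr_zdim_eq k (S := commutingVariety g) ⟨0, lie_zero _⟩
    obtain ⟨n, hn, X, hX, rfl⟩ := exists_eq_zclosure_fibration hC
    rw [← hdim, zdim_zclosure_fibration hX]
    obtain ⟨x, hx, -⟩ := hn.1
    have h1 := hmod.2 ⟨n, ⟨x, hx⟩, rfl⟩
    have h2 := zdim_mono k ((mem_Irr_iff k).1 hX).1.1
    linarith
  · obtain ⟨n, hn, h⟩ := hmod.1
    obtain ⟨X, hX, hdim⟩ := exists_mem_Irr_zdim_eq k hn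
    have h1 := zdim_mono k (zclosure_fibration_subset k X)
    rw [zdim_zclosure_fibration hX] at h1
    linarith

end Lie

end CommVar

theorem mainTheorem9 {k : Type*} [Field k] [IsAlgClosed k]
    {g : Type*} [LieRing g] [LieAlgebra k g] [FiniteDimensional k g] :
    -- vector bundle structure over the rank strata, and openness of the projection
    (∀ n : ℕ, (stratum k g n).Nonempty →
      (∃ r : ℕ, r + n = Module.finrank k g ∧
        IsVectorBundle k (fibration (stratum k g n)) (stratum k g n) r) ∧
      ZOpenMap k (pr₁ (stratum k g n))) ∧
    -- closures of preimages of components of the rank strata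
    (∀ n : ℕ, ∀ X ∈ Irr k (stratum k g n),
      zclosure k (fibration X) ⊆ commutingVariety g ∧
      ZIrreducible k (zclosure k (fibration X)) ∧
      zdim k (zclosure k (fibration X)) = zdim k X + Module.finrank k g - n) ∧
    -- dimension of the commuting variety
    zdim k (commutingVariety g) = Module.finrank k g + modality k g ∧
    -- dimension of its components
    (∀ C ∈ Irr k (commutingVariety g), ∃ nC : ℕ,
      IsGreatest {n : ℕ | (stratum k g n ∩ Prod.fst '' C).Nonempty} nC ∧
      zdim k C = zdim k (Prod.fst '' C) + Module.finrank k g - nC) ∧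
    -- a necessary condition for the closure of a preimage to be a component
    (∀ n : ℕ, ∀ X ∈ Irr k (stratum k g n),
      zclosure k (fibration X) ∈ Irr k (commutingVariety g) →
      ∀ x ∈ X, {y : g | ⁅x, y⁆ = 0} ⊆ zclosure k X ∧
        zclosure k X ⊆ zclosure k (stratum k g n) ∧
        zclosure k (stratum k g n) ⊆ ⋃ m ≤ n, stratum k g m) ∧
    -- components of maximal dimension
    (∀ n : ℕ, modality k g = zdim k (stratum k g n) - n →
      ∀ X ∈ Irr k (stratum k g n), zdim k X = zdim k (stratum k g n) →
        zclosure k (fibration X) ∈ Irr k (commutingVariety g)) := by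
  refine ⟨fun n ⟨x, hx⟩ => ?_, fun n X hX => ⟨zclosure_fibration_subset k X,
    zIrreducible_zclosure_fibration hX, zdim_zclosure_fibration hX⟩, zdim_commutingVariety k g,
    fun C hC => ?_, fun n X hX hC x hx => ⟨fun y hy => ?_, ?_, zclosure_stratum_subset k g n⟩,
    fun n hn X hX hdim => ?_⟩
  · obtain ⟨r, hr⟩ := Nat.exists_eq_add_of_le' (le_finrank_of_mem_stratum hx)
    have h := isVectorBundle_fibration (isLocallyClosed_stratum k g n) subset_rfl hr.symm
    exact ⟨⟨r, hr.symm, h⟩, h.zOpenMap_proj⟩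
  · obtain ⟨n, hn, X, hX, rfl⟩ := exists_eq_zclosure_fibration hC
    refine ⟨n, hn, ?_⟩
    -- `X ⊆ pr₁(C) ⊆ closure X`, and `X` has the dimension of its closure
    have h1 := zdim_mono k (subset_fst_image (subset_zclosure k (fibration X)))
    have h2 : zdim k (Prod.fst '' zclosure k (fibration X)) ≤ zdim k (zclosure k X) :=
      zdim_mono k (by rintro _ ⟨z, hz, rfl⟩; exact fst_mem_zclosure k hz)
    rw [zdim_zclosure k ((mem_Irr_iff k).1 hX).1.2
      (isLocallyClosed_of_mem_Irr k (isLocallyClosed_stratum k g n) hX)] at h2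
    rw [zdim_zclosure_fibration hX, le_antisymm h2 h1]
  · have h : (x, y) ∈ zclosure k (fibration X) := subset_zclosure k _ ⟨hy, hx⟩
    exact fst_mem_zclosure k (snd_snd_mem_of_mem_Irr hC h)
  · exact @closure_mono g (zariski k g) _ _ ((mem_Irr_iff k).1 hX).1.1
  · obtain ⟨C, hC, hXC⟩ := exists_mem_Irr_of_zIrreducible k (zIrreducible_zclosure_fibration hX)
      (zclosure_fibration_subset k X)
    have h1 := zdim_mono k ((mem_Irr_iff k).1 hC).1.1
    rw [zdim_commutingVariety] at h1
    have h2 := zdim_zclosure_fibration hX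
    rwa [eq_of_zdim_le k (C := zclosure k (fibration X)) (@isClosed_closure _ (zariski k _) _)
      (isClosed_of_mem_Irr k (isClosed_commutingVariety k g) hC)
      (zIrreducible_zclosure_fibration hX) ((mem_Irr_iff k).1 hC).1.2 hXC (by linarith)]
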